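/- Let $\mathcal X$ be a Polish space with its Borel $\sigma$-algebra, $\lambda>0$, let $\widetilde\mu,\mu$ be probability measures and $\widetilde p(x,dy),p(x,dy)$ probability kernels on $\mathcal X$. For a probability measure $\pi$ let $P^\pi$ be the law on $\prod_{n\ge0}(\mathcal X\times(0,\infty))$ of the Markov chain $(X^J_n,\Delta_n)_{n\ge 0}$ with initial law $\pi\times\lambda e^{-\lambda t}dt$ and transition kernel $((x,s),\cdot)\mapsto p(x,dy)\times\lambda e^{-\lambda t}dt$, restricted to $\Omega=\{\sum_n\Delta_n=\infty\}$ (a set of full measure); $\widetilde P^{\pi}$ is defined in the same way from $\widetilde p$ and the same $\lambda$. Write $\widetilde E^{\pi}$ for the expectation under $\widetilde P^{\pi}$. On $\Omega$ put $J_0=0$, $J_n=\sum_{k<n}\Delta_k$, and $X_t=X^J_n$ for $J_n\le t<J_{n+1}$, $t\ge 0$. Let $$\mathcal F_t=\sigma(X_s:s\le t),\qquad \mathcal G_t=\sigma(1_{J_n\le s},\,X_{J_n\wedge s}: s\le t,\ n\ge0).$$ Write $R(\cdot\|\cdot)\in[0,\infty]$ for relative entropy, and $\widetilde{\mathcal P}^*[\nu]=\int\widetilde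 p(x,\cdot)\,\nu(dx)$. **(a)** Assume that $\widetilde\mu\ll\mu$, that $\widetilde p(x,\cdot)\ll p(x,\cdot)$ for $\widetilde\mu$-a.e. $x$, and that $(\widetilde{\mathcal P}^*)^n[\widetilde\mu]\ll\widetilde\mu$ for all $n\ge 0$. Then there is a measurable $h:\mathcal X\times\mathcal X\to[0,\infty)$ with $$\widetilde p(x,dy)=h(x,y)\,p(x,dy)\quad\text{for }\widetilde\mu\text{-a.e. }x, \tag{1}$$ and for every measurable $h:\mathcal X\times\mathcal X\to[0,\infty]$ satisfying (1) and every $t\ge0$: 1. $\widetilde P^{\widetilde\mu}|_{\mathcal G_t}\ll P^\mu|_{\mathcal G_t}$ and, $P^\mu|_{\mathcal G_t}$-a.s., $$\frac{d\widetilde P^{\widetilde\mu}|_{\mathcal G_t}}{dP^\mu|_{\mathcal G_t}}=\frac{d\widetilde\mu}{d\mu}(X_0)\prod_{n\ge1:\,J_n\le t}h(X_{J_{n-1}\wedge t},X_{J_n\wedge t});$$ 2. as an identity in $[0,\infty]$, $$R(\widetilde P^{\widetilde\mu}|_{\mathcal G_t}\|P^\mu|_{\mathcal G_t})=R(\widetilde\mu\|\mu)+\lambda\int_0^t\widetilde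 E^{\widetilde\mu}\Big[\int h(X_s,z)\log h(X_s,z)\,p(X_s,dz)\Big]ds,$$ where $0\log 0=0$ and the integrals are extended-real-valued; 3. $\mathcal F_t\subset\mathcal G_t$ and $R(\widetilde P^{\widetilde\mu}|_{\mathcal F_t}\|P^\mu|_{\mathcal F_t})\le R(\widetilde P^{\widetilde\mu}|_{\mathcal G_t}\|P^\mu|_{\mathcal G_t})$. **(b)** If $\widetilde\mu^*$ is a probability measure that is invariant for $\widetilde p$ (with no absolute continuity assumed), then for all $t>0$ $$R(\widetilde P^{\widetilde\mu^*}|_{\mathcal F_t}\|P^\mu|_{\mathcal F_t})\le R(\widetilde\mu^*\|\mu)+\lambda t\int R(\widetilde p(x,\cdot)\|p(x,\cdot))\,\widetilde\mu^*(dx).$$ -/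

import Mathlib

open MeasureTheory ProbabilityTheory InformationTheory Filter Topology Set
open scoped NNReal ENNReal

noncomputable section

namespace JumpProcess

/-! ### The law of the jump chain -/

/-- The space `(0, ∞)` of holding times. -/
abbrev HoldingTime : Type := Ioi (0 : ℝ)

/-- The exponential law `lam * exp (-lam * t) dt` on `(0, ∞)`. -/
def holdingLaw (lam : Ioi (0 : ℝ)) : Measure HoldingTime :=
  ((volume : Measure ℝ).comap Subtype.val : Measure HoldingTime).withDensity
    fun t => ENNReal.ofReal ((lam : ℝ) * Real.exp (-((lam : ℝ) * (t : ℝ))))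

instance (lam : Ioi (0 : ℝ)) : IsProbabilityMeasure (holdingLaw lam) := by
  obtain ⟨r, hr⟩ := lam
  have hr' : 0 < r := hr
  refine ⟨?_⟩
  rw [holdingLaw, withDensity_apply _ MeasurableSet.univ, Measure.restrict_univ]
  have h1 : ∫⁻ t : HoldingTime, ENNReal.ofReal (r * Real.exp (-(r * (t : ℝ))))
        ∂((volume : Measure ℝ).comap Subtype.val)
      = ∫⁻ t in Ioi (0 : ℝ), ENNReal.ofReal (r * Real.exp (-(r * t))) :=
    lintegral_subtype_comap (μ := volume) measurableSet_Ioi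
      (fun t : ℝ => ENNReal.ofReal (r * Real.exp (-(r * t))))
  refine h1.trans ?_
  simp only [← neg_mul]
  rw [← ofReal_integral_eq_lintegral_ofReal]
  · rw [integral_const_mul, integral_exp_mul_Ioi (by linarith) 0]
    simp [hr'.ne']
  · exact (integrableOn_exp_mul_Ioi (by linarith) 0).const_mul r
  · exact Eventually.of_forall fun t => by positivity

variable {X : Type*} [MeasurableSpace X]

/-- The kernel `((x, s), ·) ↦ p(x, dy) × lam * exp (-lam * t) dt` on `X × (0, ∞)`. -/
def stepKernel (lam : Ioi (0 : ℝ)) (p : Kernel X X) : Kernel (X × HoldingTime) (X × HoldingTime) :=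
  p.prodMkRight HoldingTime ×ₖ Kernel.const (X × HoldingTime) (holdingLaw lam)

instance (lam : Ioi (0 : ℝ)) (p : Kernel X X) [IsMarkovKernel p] :
    IsMarkovKernel (stepKernel lam p) := by
  unfold stepKernel; infer_instance

/-- `stepKernel`, as the conditional law of the state number `n + 1` of the chain given its states
`0, …, n`; it only reads the state number `n`. -/
def historyKernel (lam : Ioi (0 : ℝ)) (p : Kernel X X) (n : ℕ) :
    Kernel ((_ : Finset.Iic n) → X × HoldingTime) (X × HoldingTime) :=
  (stepKernel lam p).comap (fun ω => ω ⟨n, Finset.mem_Iic.2 le_rfl⟩) (measurable_pi_apply _)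

instance (lam : Ioi (0 : ℝ)) (p : Kernel X X) [IsMarkovKernel p] (n : ℕ) :
    IsMarkovKernel (historyKernel lam p n) := by
  unfold historyKernel; infer_instance

/-- The law on `(X × (0, ∞))^ℕ` of the time-homogeneous Markov chain with transition kernel
`stepKernel lam p` and initial law `π × lam * exp (-lam * t) dt`. -/
def chainLaw (lam : Ioi (0 : ℝ)) (p : Kernel X X) [IsMarkovKernel p] (π : Measure X) :
    Measure (ℕ → X × HoldingTime) :=
  Kernel.trajMeasure (X := fun _ : ℕ => X × HoldingTime) (π.prod (holdingLaw lam))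
    (historyKernel lam p)

/-! ### The path space and the jump process -/

variable (X) in
/-- The sequences `(xᵢ, sᵢ)` with `∑ sᵢ = ∞`. -/
def explosionFree : Set (ℕ → X × HoldingTime) :=
  {ω | Tendsto (fun n => ∑ k ∈ Finset.range n, ((ω k).2 : ℝ)) atTop atTop}

variable (X) in
/-- The sample space, with the trace of the product σ-algebra. -/
abbrev Path : Type _ := explosionFree X

variable (X) in
theorem measurableSet_explosionFree : MeasurableSet (explosionFree X) :=
  measurableSet_tendsto (l := atTop) (l' := atTop)
    (f := fun (n : ℕ) (ω : ℕ → X × HoldingTime) => ∑ k ∈ Finset.range n, ((ω k).2 : ℝ))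
    (fun n => by fun_prop)

/-- The path measure: the restriction of `chainLaw lam p π` to the sample space. -/
def pathMeasure (lam : Ioi (0 : ℝ)) (p : Kernel X X) [IsMarkovKernel p] (π : Measure X) :
    Measure (Path X) :=
  (chainLaw lam p π).comap Subtype.val

/-- The jump chain. -/
def jumpChain (n : ℕ) (ω : Path X) : X := (ω.1 n).1

/-- The jump times: `J 0 = 0` and `J n = Δ 0 + … + Δ (n - 1)`. -/
def jumpTime (n : ℕ) (ω : Path X) : ℝ := ∑ k ∈ Finset.range n, ((ω.1 k).2 : ℝ)

theorem exists_lt_jumpTime (t : ℝ) (ω : Path X) : ∃ n, t < jumpTime (n + 1) ω :=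
  (((tendsto_add_atTop_iff_nat 1).2 ω.2).eventually_gt_atTop t).exists

open Classical in
/-- The number `n` with `J n ≤ t < J (n + 1)` (for `0 ≤ t`), that is, the number of jumps up to
time `t`. -/
def jumpCount (t : ℝ) (ω : Path X) : ℕ := Nat.find (exists_lt_jumpTime t ω)

/-- The jump process: `X_t = X^J_n` for `J n ≤ t < J (n + 1)`. -/
def process (t : ℝ) (ω : Path X) : X := jumpChain (jumpCount t ω) ω

theorem strictMono_jumpTime (ω : Path X) : StrictMono fun n => jumpTime n ω :=
  strictMono_nat_of_lt_succ fun n => by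
    have h : (0 : ℝ) < (ω.1 n).2 := (ω.1 n).2.2
    simp only [jumpTime, Finset.sum_range_succ]
    linarith

theorem jumpTime_le_iff {t : ℝ} (ht : 0 ≤ t) (n : ℕ) (ω : Path X) :
    jumpTime n ω ≤ t ↔ n ≤ jumpCount t ω := by
  classical
  constructor
  · intro h
    by_contra! hn
    have h1 : t < jumpTime (jumpCount t ω + 1) ω := Nat.find_spec (exists_lt_jumpTime t ω)
    exact absurd (h1.trans_le ((strictMono_jumpTime ω).monotone hn)) (not_lt.2 h)
  · intro h
    rcases n with _ | n
    · simpa [jumpTime] using ht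
    · exact not_lt.1 (Nat.find_min (exists_lt_jumpTime t ω) h)

theorem jumpTime_jumpCount_le {t : ℝ} (ht : 0 ≤ t) (ω : Path X) :
    jumpTime (jumpCount t ω) ω ≤ t ∧ t < jumpTime (jumpCount t ω + 1) ω :=
  ⟨(jumpTime_le_iff ht _ ω).2 le_rfl, not_le.1 fun h => by
    have := (jumpTime_le_iff ht _ ω).1 h
    omega⟩

@[fun_prop]
theorem measurable_jumpChain (n : ℕ) : Measurable (jumpChain (X := X) n) := by
  exact measurable_fst.comp ((measurable_pi_apply n).comp measurable_subtype_coe)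

@[fun_prop]
theorem measurable_jumpTime (n : ℕ) : Measurable (jumpTime (X := X) n) := by
  exact Finset.measurable_sum _ fun k _ => measurable_subtype_coe.comp
    (measurable_snd.comp ((measurable_pi_apply k).comp measurable_subtype_coe))

theorem measurable_process_comp {τ : Path X → ℝ} (hτ : Measurable τ) :
    Measurable fun ω => process (τ ω) ω := by
  classical
  exact Measurable.find (f := fun n => jumpChain (X := X) n)
    (p := fun n ω => τ ω < jumpTime (n + 1) ω) measurable_jumpChain
    (fun n => measurableSet_lt hτ (measurable_jumpTime _))
    (fun ω => exists_lt_jumpTime (τ ω) ω)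

/-! ### The two filtrations -/

variable (X) in
/-- The natural filtration of the process, `𝓕_t = σ(X_s : s ≤ t)`. -/
def naturalFiltration : Filtration ℝ≥0 (inferInstance : MeasurableSpace (Path X)) where
  seq t := ⨆ s : ℝ≥0, ⨆ _ : s ≤ t,
    MeasurableSpace.comap (fun ω => process (s : ℝ) ω) inferInstance
  mono' _ _ h := biSup_mono fun _ hs => hs.trans h
  le' _ := iSup₂_le fun _ _ => (measurable_process_comp measurable_const).comap_le

variable (X) in
/-- The enlarged filtration `𝓖_t = σ(1_{J n ≤ s}, X_{J n ∧ s} : s ≤ t, n ≥ 0)`. -/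
def enlargedFiltration : Filtration ℝ≥0 (inferInstance : MeasurableSpace (Path X)) where
  seq t := ⨆ s : ℝ≥0, ⨆ _ : s ≤ t, ⨆ n : ℕ,
    MeasurableSpace.comap ({ω : Path X | jumpTime n ω ≤ s}.indicator fun _ => (1 : ℝ))
        inferInstance ⊔
      MeasurableSpace.comap (fun ω : Path X => process (min (jumpTime n ω) s) ω) inferInstance
  mono' _ _ h := biSup_mono fun _ hs => hs.trans h
  le' _ := iSup₂_le fun _ _ => iSup_le fun n => sup_le
    ((measurable_const.indicator
      (measurableSet_le (measurable_jumpTime n) measurable_const)).comap_le)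
    ((measurable_process_comp ((measurable_jumpTime n).min measurable_const)).comap_le)

/-- The restriction `P|_{𝓕_t}` of a measure on the sample space. -/
def restrictF (P : Measure (Path X)) (t : ℝ≥0) : @Measure (Path X) (naturalFiltration X t) :=
  P.trim ((naturalFiltration X).le t)

/-- The restriction `P|_{𝓖_t}` of a measure on the sample space. -/
def restrictG (P : Measure (Path X)) (t : ℝ≥0) : @Measure (Path X) (enlargedFiltration X t) :=
  P.trim ((enlargedFiltration X).le t)

/-! ### The density and the extended integral -/

/-- `(dν/dμ)(X_0) * ∏_{n ≥ 1, J n ≤ t} h(X_{J (n-1) ∧ t}, X_{J n ∧ t})`. By `jumpTime_le_iff` the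
indices of the product are exactly `1, …, jumpCount t ω`. -/
def pathDensity (ν μ : Measure X) (h : X → X → ℝ≥0∞) (t : ℝ≥0) (ω : Path X) : ℝ≥0∞ :=
  ν.rnDeriv μ (process 0 ω) *
    ∏ n ∈ Finset.Icc 1 (jumpCount t ω),
      h (process (min (jumpTime (n - 1) ω) t) ω) (process (min (jumpTime n ω) t) ω)

/-- The integral, in the extended reals, of an extended real valued function: the integral of the
positive part minus the integral of the negative part. If both are infinite, it has the value
`⊥ = -∞`. -/
def eintegral {α : Type*} [MeasurableSpace α] (μ : Measure α) (f : α → EReal) : EReal :=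
  ((∫⁻ x, (f x).toENNReal ∂μ : ℝ≥0∞) : EReal) - ((∫⁻ x, (-f x).toENNReal ∂μ : ℝ≥0∞) : EReal)

/-- `∫ h(x, z) log h(x, z) p(x, dz)`, with `0 log 0 = 0`. -/
def localEntropy (p : Kernel X X) (h : X → X → ℝ≥0∞) (x : X) : EReal :=
  eintegral (p x) fun z => (((h x z).toReal * Real.log (h x z).toReal : ℝ) : EReal)

end JumpProcess

end

namespace JumpProcess

variable {X : Type*} [MeasurableSpace X]

/-! ### Integration against the law of the chain -/

/-! Write `Z_n = (dμ'/dμ)(X_0) ∏_{k<n} h(X^J_k, X^J_{k+1})` and let `N_t` be the number of jumps up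
to time `t`. Both chains draw their holding times from the same exponential law, so these cancel and
`Z_n` is the density of the primed law on functions of the states `0, …, n`. Such functions are
encoded as functions `F` on path space with `F (freeze n ω) = F ω`, which avoids a separate space of
finite histories.

The event `N_t = n` is `J_n ≤ t < J_{n+1}` and reads only the states `0, …, n`. Summing over its
values shows that `Z_{N_t}` is the density on functions of the path frozen at index `N_t`
(`IsStopIndex.lintegral_eq`). Events of `𝓖_t` are of this kind, and `Z_{N_t}` is the product in the
theorem and is `𝓖_t`-measurable; hence it is the density on `𝓖_t`.

For the entropy, let `φ(a) = a log a + 1 - a ≥ 0`. If `∫ f = 1`, then `∫ φ(a f) = φ(a) + a ∫ φ(f)`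
(`lintegral_klFunENN_mul`). With `a = Z_n`, the jump number `n + 1` contributes the primed
expectation of `K(X^J_n)` on `J_{n+1} ≤ t`, where `K(x) = ∫ φ(h(x, y)) p(x, dy)`
(`lintegral_klFunENN_min_succ`). Fatou and the data processing inequality give the limit of
infinitely many jumps with no finiteness assumption. The compensator `lam dt` of the jump counts
turns the sum over jumps into a time integral, and `K` equals `∫ h log h dp` because `∫ h dp = 1`.

For an invariant initial law the sum is `lam t ∫ K dμ'`. A finite right-hand side forces the
absolute continuity needed for the first part, and passing from `𝓖_t` to the smaller `𝓕_t` can only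
lose entropy. -/

theorem lintegral_stepKernel (lam : Ioi (0 : ℝ)) (p : Kernel X X) [IsMarkovKernel p]
    (z : X × HoldingTime) {G : X × HoldingTime → ℝ≥0∞} (hG : Measurable G) :
    ∫⁻ w, G w ∂stepKernel lam p z = ∫⁻ y, ∫⁻ r, G (y, r) ∂holdingLaw lam ∂p z.1 := by
  rw [stepKernel, Kernel.prod_apply, Kernel.prodMkRight_apply, Kernel.const_apply,
    lintegral_prod _ hG.aemeasurable]

variable (lam : Ioi (0 : ℝ)) (p : Kernel X X) [IsMarkovKernel p] (π : Measure X)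
  [IsProbabilityMeasure π]

instance : IsProbabilityMeasure (chainLaw lam p π) := by
  unfold chainLaw; infer_instance

omit [IsProbabilityMeasure π] in
theorem map_eval_zero_chainLaw :
    (chainLaw lam p π).map (fun ω => ω 0) = π.prod (holdingLaw lam) := by
  have h : (chainLaw lam p π).map (Preorder.frestrictLe (π := fun _ : ℕ => X × HoldingTime) 0)
      = (π.prod (holdingLaw lam)).map
        (MeasurableEquiv.piUnique (fun _ : Finset.Iic 0 => X × HoldingTime)).symm := by
    rw [chainLaw, Kernel.trajMeasure, Measure.map_comp _ _ (by fun_prop),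
      Kernel.traj_map_frestrictLe, Kernel.partialTraj_self]
    exact Measure.id_comp
  have h2 := congrArg (fun m => m.map
    (MeasurableEquiv.piUnique (fun _ : Finset.Iic 0 => X × HoldingTime))) h
  simp only at h2
  rw [Measure.map_map (by fun_prop) (by fun_prop),
    Measure.map_map (by fun_prop) (by fun_prop)] at h2
  have h3 : ⇑(MeasurableEquiv.piUnique (fun _ : Finset.Iic 0 => X × HoldingTime)) ∘
      ⇑(MeasurableEquiv.piUnique (fun _ : Finset.Iic 0 => X × HoldingTime)).symm = id := by
    ext1 x; simp
  rw [h3, Measure.map_id] at h2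
  exact h2

/-- The sequence that repeats its term number `n` from there on. -/
def freezeSeq {Z : Type*} (n : ℕ) (ω : ℕ → Z) : ℕ → Z := fun k => ω (min k n)

/-- This is the Ionescu-Tulcea disintegration at step `n`. The frozen sequence carries the same
information as the history indexed by `Finset.Iic n`, but lives in a space that does not depend on
`n`. -/
theorem lintegral_chainLaw_succ (n : ℕ) {G : (ℕ → X × HoldingTime) × X × HoldingTime → ℝ≥0∞}
    (hG : Measurable G) :
    ∫⁻ ω, G (freezeSeq n ω, ω (n + 1)) ∂chainLaw lam p π
      = ∫⁻ ω, ∫⁻ z, G (freezeSeq n ω, z) ∂stepKernel lam p (ω n) ∂chainLaw lam p π := by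
  let e : ((_ : Finset.Iic n) → X × HoldingTime) → ℕ → X × HoldingTime :=
    fun y k => y ⟨min k n, by simp⟩
  have he : Measurable e := by fun_prop
  have h := Kernel.map_frestrictLe_trajMeasure_compProd_eq_map_trajMeasure
    (X := fun _ : ℕ => X × HoldingTime) (μ₀ := π.prod (holdingLaw lam)) (κ := historyKernel lam p) (a := n)
  have h2 := congrArg (fun m => ∫⁻ y, G (e y.1, y.2) ∂m) h
  have hm : Measurable fun y : ((_ : Finset.Iic n) → X × HoldingTime) × X × HoldingTime =>
      G (e y.1, y.2) := by fun_prop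
  rw [Measure.lintegral_compProd hm, lintegral_map hm (by fun_prop),
    lintegral_map (by exact hm.lintegral_kernel_prod_right') (by fun_prop)] at h2
  exact h2.symm

/-! ### Non-explosion -/

theorem lintegral_exp_neg_holdingLaw_lt_one :
    ∫⁻ s : HoldingTime, ENNReal.ofReal (Real.exp (-(s : ℝ))) ∂holdingLaw lam < 1 := by
  have h1 : ∀ s : HoldingTime, ENNReal.ofReal (Real.exp (-(s : ℝ))) < 1 := fun s => by
    rw [ENNReal.ofReal_lt_one, Real.exp_lt_one_iff]
    exact neg_lt_zero.2 s.2
  calc _ < ∫⁻ s : HoldingTime, 1 ∂holdingLaw lam :=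
        lintegral_strict_mono (IsProbabilityMeasure.ne_zero _) aemeasurable_const
          (((lintegral_mono fun s => (h1 s).le).trans_lt (by simp)).ne)
          (Eventually.of_forall h1)
    _ = 1 := by simp

/-- The holding times are independent and identically distributed, so the Laplace transform of `J_n`
at `1` is a power. -/
theorem lintegral_exp_neg_sum_chainLaw (n : ℕ) :
    ∫⁻ ω, ENNReal.ofReal (Real.exp (-∑ k ∈ Finset.range n, ((ω k).2 : ℝ))) ∂chainLaw lam p π
      = (∫⁻ s : HoldingTime, ENNReal.ofReal (Real.exp (-(s : ℝ))) ∂holdingLaw lam) ^ n := by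
  induction n with
  | zero => simp
  | succ n ih =>
    rcases n with _ | n
    · have h : ∫⁻ ω, ENNReal.ofReal (Real.exp (-((ω 0).2 : ℝ))) ∂chainLaw lam p π
          = ∫⁻ z : X × HoldingTime, ENNReal.ofReal (Real.exp (-(z.2 : ℝ)))
            ∂(π.prod (holdingLaw lam)) := by
        rw [← map_eval_zero_chainLaw lam p π, lintegral_map (by fun_prop) (by fun_prop)]
      simp [h, lintegral_prod _ (show AEMeasurable (fun z : X × HoldingTime =>
        ENNReal.ofReal (Real.exp (-(z.2 : ℝ)))) (π.prod (holdingLaw lam)) by fun_prop)]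
    · have hs : ∀ ω : ℕ → X × HoldingTime,
          ∑ k ∈ Finset.range (n + 1), ((freezeSeq n ω k).2 : ℝ)
            = ∑ k ∈ Finset.range (n + 1), ((ω k).2 : ℝ) := fun ω =>
        Finset.sum_congr rfl fun k hk => by
          rw [freezeSeq, min_eq_left (by simpa [Nat.lt_succ_iff] using hk)]
      have h := lintegral_chainLaw_succ lam p π n
        (G := fun y => ENNReal.ofReal (Real.exp (-∑ k ∈ Finset.range (n + 1), ((y.1 k).2 : ℝ)))
          * ENNReal.ofReal (Real.exp (-(y.2.2 : ℝ)))) (by fun_prop)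
      simp only [hs] at h
      rw [pow_succ, ← ih, ← lintegral_mul_const _ (by fun_prop)]
      refine Eq.trans ?_ (h.trans ?_)
      · refine lintegral_congr fun ω => ?_
        rw [← ENNReal.ofReal_mul (by positivity), ← Real.exp_add,
          Finset.sum_range_succ _ (n + 1), neg_add]
      · refine lintegral_congr fun ω => ?_
        rw [lintegral_const_mul _ (by fun_prop), lintegral_stepKernel _ _ _ (by fun_prop)]
        simp

/-- The expectations of `exp (-J_n)` form a convergent geometric series. Hence `exp (-J_n)` is
almost surely summable, so it tends to `0`, and `J_n` tends to infinity. -/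
theorem ae_mem_explosionFree : ∀ᵐ ω ∂chainLaw lam p π, ω ∈ explosionFree X := by
  have h : ∫⁻ ω, ∑' n, ENNReal.ofReal (Real.exp (-∑ k ∈ Finset.range n, ((ω k).2 : ℝ)))
      ∂chainLaw lam p π ≠ ∞ := by
    rw [lintegral_tsum (fun n => Measurable.aemeasurable (by fun_prop))]
    simp_rw [lintegral_exp_neg_sum_chainLaw, ENNReal.tsum_geometric]
    exact ENNReal.inv_ne_top.2 (tsub_pos_of_lt (lintegral_exp_neg_holdingLaw_lt_one lam)).ne'
  filter_upwards [ae_lt_top (by fun_prop) h] with ω hω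
  have h1 := ENNReal.tendsto_atTop_zero_of_tsum_ne_top hω.ne
  have h2 := (ENNReal.tendsto_toReal ENNReal.zero_ne_top).comp h1
  simp only [Function.comp_def, ENNReal.toReal_ofReal (Real.exp_nonneg _),
    ENNReal.toReal_zero] at h2
  exact tendsto_neg_atBot_iff.1 (Real.tendsto_exp_comp_nhds_zero.1 h2)

theorem map_val_pathMeasure :
    (pathMeasure lam p π).map Subtype.val = chainLaw lam p π := by
  rw [pathMeasure, (MeasurableEmbedding.subtype_coe (measurableSet_explosionFree X)).map_comap,
    Subtype.range_coe, Measure.restrict_eq_self_of_ae_mem (ae_mem_explosionFree lam p π)]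

instance : IsProbabilityMeasure (pathMeasure lam p π) := by
  refine ⟨?_⟩
  have h := measure_univ (μ := chainLaw lam p π)
  rwa [← map_val_pathMeasure, Measure.map_apply measurable_subtype_coe .univ] at h

/-! ### Frozen paths and the Markov property -/

omit [MeasurableSpace X] in
theorem freezeSeq_mem_explosionFree (n : ℕ) (ω : ℕ → X × HoldingTime) :
    freezeSeq n ω ∈ explosionFree X := by
  have h0 : (0 : ℝ) < (ω n).2 := (ω n).2.2
  have h1 : ∀ m, ∑ k ∈ Finset.range (m + n), ((freezeSeq n ω k).2 : ℝ)
      = m * ((ω n).2 : ℝ) + ∑ k ∈ Finset.range n, ((freezeSeq n ω k).2 : ℝ) := fun m => by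
    induction m with
    | zero => simp
    | succ m ih =>
      rw [add_right_comm, Finset.sum_range_succ, ih, freezeSeq, min_eq_right (by omega)]
      push_cast; ring
  rw [explosionFree, mem_ofPred_eq, ← tendsto_add_atTop_iff_nat n]
  simp_rw [h1]
  exact tendsto_atTop_add_const_right _ _ (tendsto_natCast_atTop_atTop.atTop_mul_const h0)

/-- The path that repeats its state number `n` from there on. -/
def freeze (n : ℕ) (ω : Path X) : Path X :=
  ⟨freezeSeq n ω.1, freezeSeq_mem_explosionFree n ω.1⟩

@[fun_prop]
theorem measurable_freeze (n : ℕ) : Measurable (freeze (X := X) n) := by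
  refine Measurable.subtype_mk (measurable_pi_lambda _ fun k => ?_)
  exact (measurable_pi_apply (min k n)).comp measurable_subtype_coe

/-- The holding time in the state number `n`. -/
def holdingTime (n : ℕ) (ω : Path X) : HoldingTime := (ω.1 n).2

@[fun_prop]
theorem measurable_holdingTime (n : ℕ) : Measurable (holdingTime (X := X) n) := by
  exact measurable_snd.comp ((measurable_pi_apply n).comp measurable_subtype_coe)

omit [MeasurableSpace X] in
theorem jumpTime_succ (n : ℕ) (ω : Path X) :
    jumpTime (n + 1) ω = jumpTime n ω + holdingTime n ω := by
  simp [jumpTime, holdingTime, Finset.sum_range_succ]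

theorem lintegral_pathMeasure_zero {G : X → HoldingTime → ℝ≥0∞}
    (hG : Measurable (Function.uncurry G)) :
    ∫⁻ ω, G (jumpChain 0 ω) (holdingTime 0 ω) ∂pathMeasure lam p π
      = ∫⁻ x, ∫⁻ r, G x r ∂holdingLaw lam ∂π := by
  have h := lintegral_prod (μ := π) (ν := holdingLaw lam) (Function.uncurry G) hG.aemeasurable
  simp only [Function.uncurry_apply_pair] at h
  rw [← h, ← map_eval_zero_chainLaw lam p π,
    lintegral_map hG (by fun_prop), ← map_val_pathMeasure lam p π,
    lintegral_map (by fun_prop) measurable_subtype_coe]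
  rfl

/-- The Markov property at the step from `n` to `n + 1`. -/
theorem lintegral_pathMeasure_succ (n : ℕ) {G : Path X → X → HoldingTime → ℝ≥0∞}
    (hG : Measurable fun y : Path X × X × HoldingTime => G y.1 y.2.1 y.2.2)
    (hn : ∀ ω, G (freeze n ω) = G ω) :
    ∫⁻ ω, G ω (jumpChain (n + 1) ω) (holdingTime (n + 1) ω) ∂pathMeasure lam p π
      = ∫⁻ ω, ∫⁻ x, ∫⁻ r, G ω x r ∂holdingLaw lam ∂p (jumpChain n ω) ∂pathMeasure lam p π := by
  -- `G` is only defined on non-explosive paths. It is extended measurably to all sequences; the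
  -- values off the sample space do not matter, since frozen sequences never explode.
  have hemb : MeasurableEmbedding (Prod.map Subtype.val id :
      Path X × X × HoldingTime → (ℕ → X × HoldingTime) × X × HoldingTime) :=
    (MeasurableEmbedding.subtype_coe (measurableSet_explosionFree X)).prodMap .id
  obtain ⟨G', hG', hGG'⟩ := hemb.exists_measurable_extend hG fun _ => ⟨0⟩
  have key : ∀ (ω : Path X) (z : X × HoldingTime), G' (freezeSeq n ω.1, z) = G ω z.1 z.2 :=
    fun ω z => by
      rw [← hn ω]
      exact congrFun hGG' (freeze n ω, z)
  have hfr : Measurable fun ω : ℕ → X × HoldingTime => freezeSeq n ω :=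
    measurable_pi_lambda _ fun k => measurable_pi_apply _
  have h := lintegral_chainLaw_succ lam p π n hG'
  have hm : Measurable fun ω : ℕ → X × HoldingTime =>
      ∫⁻ z, G' (freezeSeq n ω, z) ∂stepKernel lam p (ω n) :=
    Measurable.lintegral_kernel_prod_right' (κ := (stepKernel lam p).comap
      (fun ω : ℕ → X × HoldingTime => ω n) (measurable_pi_apply n))
      (f := fun y => G' (freezeSeq n y.1, y.2)) (by fun_prop)
  rw [← map_val_pathMeasure lam p π, lintegral_map (by fun_prop) measurable_subtype_coe,
    lintegral_map hm measurable_subtype_coe] at h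
  simp only [key] at h
  refine h.trans (lintegral_congr fun ω => ?_)
  rw [lintegral_stepKernel _ _ _ (G := fun z => G ω z.1 z.2) (by fun_prop)]
  rfl

end JumpProcess

namespace JumpProcess

variable {X : Type*} [MeasurableSpace X]

/-! ### Relative entropy of a measure with a density -/

/-- `a * log a + 1 - a`, as a function on `[0, ∞]`. -/
noncomputable def klFunENN (a : ℝ≥0∞) : ℝ≥0∞ := ENNReal.ofReal (klFun a.toReal)

@[fun_prop]
theorem measurable_klFunENN : Measurable klFunENN :=
  (measurable_klFun.comp ENNReal.measurable_toReal).ennreal_ofReal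

section Entropy

variable {α : Type*} [MeasurableSpace α] {ν : Measure α} {f : α → ℝ≥0∞}

theorem klDiv_withDensity {α : Type*} {mα : MeasurableSpace α} {ν : Measure α} {f : α → ℝ≥0∞}
    [IsFiniteMeasure ν] (hf : Measurable f)
    [IsFiniteMeasure (ν.withDensity f)] :
    klDiv (ν.withDensity f) ν = ∫⁻ x, klFunENN (f x) ∂ν := by
  rw [klDiv_eq_lintegral_klFun_of_ac (withDensity_absolutelyContinuous ν f)]
  refine lintegral_congr_ae ?_
  filter_upwards [Measure.rnDeriv_withDensity ν hf] with x hx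
  rw [hx, klFunENN]

/-- This is `φ(ab) = φ(a) + a φ(b) + a log a (b - 1)`. The last term has no sign, so `a log a` is
split into its positive and negative parts and every negative contribution is moved to the other
side. -/
theorem klFunENN_mul {a b : ℝ≥0∞} (ha : a ≠ ∞) (hb : b ≠ ∞) :
    klFunENN (a * b) + (ENNReal.ofReal (a.toReal * Real.log a.toReal)
        + ENNReal.ofReal (-(a.toReal * Real.log a.toReal)) * b)
      = klFunENN a + a * klFunENN b + (ENNReal.ofReal (a.toReal * Real.log a.toReal) * b
        + ENNReal.ofReal (-(a.toReal * Real.log a.toReal))) := by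
  lift a to ℝ≥0 using ha
  lift b to ℝ≥0 using hb
  simp only [klFunENN, ENNReal.toReal_mul, ENNReal.coe_toReal]
  have ha0 : (0 : ℝ) ≤ a := a.2
  have hb0 : (0 : ℝ) ≤ b := b.2
  have k1 := klFun_nonneg (mul_nonneg ha0 hb0)
  have k2 := klFun_nonneg ha0
  have k3 := klFun_nonneg hb0
  have key : klFun (a * b : ℝ) = klFun a + a * klFun b + a * Real.log a * (b - 1) := by
    simp only [klFun_apply]
    rcases eq_or_ne (a : ℝ) 0 with h | h
    · simp [h]
    rcases eq_or_ne (b : ℝ) 0 with h' | h'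
    · simp [h']
    rw [Real.log_mul h h']
    ring
  rw [← ENNReal.ofReal_coe_nnreal (p := a), ← ENNReal.ofReal_coe_nnreal (p := b)]
  rcases le_total 0 ((a : ℝ) * Real.log a) with h | h
  · rw [ENNReal.ofReal_of_nonpos (neg_nonpos.2 h), zero_mul, add_zero, add_zero,
      ← ENNReal.ofReal_mul ha0, ← ENNReal.ofReal_mul h, ← ENNReal.ofReal_add k1 h,
      ← ENNReal.ofReal_add k2 (by positivity), ← ENNReal.ofReal_add (by positivity) (by positivity)]
    congr 1
    linarith
  · have h' := neg_nonneg.2 h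
    rw [ENNReal.ofReal_of_nonpos h, zero_mul, zero_add, zero_add,
      ← ENNReal.ofReal_mul ha0, ← ENNReal.ofReal_mul h', ← ENNReal.ofReal_add k1 (by positivity),
      ← ENNReal.ofReal_add k2 (by positivity), ← ENNReal.ofReal_add (by positivity) h']
    congr 1
    linarith

/-- The chain rule for relative entropy: as `f` has mean one, the terms in `a log a` integrate to
the same finite amount on both sides and cancel. -/
theorem lintegral_klFunENN_mul [IsProbabilityMeasure ν] (hf : Measurable f)
    (hf1 : ∫⁻ x, f x ∂ν = 1) {a : ℝ≥0∞} (ha : a ≠ ∞) :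
    ∫⁻ x, klFunENN (a * f x) ∂ν = klFunENN a + a * ∫⁻ x, klFunENN (f x) ∂ν := by
  set c := ENNReal.ofReal (a.toReal * Real.log a.toReal)
  set d := ENNReal.ofReal (-(a.toReal * Real.log a.toReal))
  have h : ∫⁻ x, (klFunENN (a * f x) + (c + d * f x)) ∂ν
      = ∫⁻ x, (klFunENN a + a * klFunENN (f x) + (c * f x + d)) ∂ν := by
    refine lintegral_congr_ae ?_
    -- At `∞`, `klFunENN` takes a meaningless value coming from `toReal`; the unit integral of `f`
    -- makes that set null.
    filter_upwards [ae_lt_top hf (by simp [hf1])] with x hx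
    exact klFunENN_mul ha hx.ne
  rw [lintegral_add_left (by fun_prop), lintegral_add_left (by fun_prop),
    lintegral_add_left (by fun_prop), lintegral_add_left (by fun_prop),
    lintegral_add_left (by fun_prop), lintegral_const_mul _ hf, lintegral_const_mul _ hf,
    lintegral_const_mul _ (by fun_prop), hf1] at h
  simp only [lintegral_const, measure_univ, mul_one] at h
  exact (ENNReal.add_left_inj (ENNReal.add_ne_top.2
    ⟨ENNReal.ofReal_ne_top, ENNReal.ofReal_ne_top⟩)).1 h

theorem eintegral_congr_ae {g g' : α → EReal} (h : g =ᵐ[ν] g') :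
    eintegral ν g = eintegral ν g' := by
  unfold eintegral
  rw [lintegral_congr_ae (h.mono fun x hx => by rw [hx]),
    lintegral_congr_ae (f := fun x => (-g x).toENNReal) (g := fun x => (-g' x).toENNReal)
      (h.mono fun x hx => by simp only [hx])]

theorem eintegral_coe (ν : Measure α) (g : α → ℝ≥0∞) :
    eintegral ν (fun x => (g x : EReal)) = ((∫⁻ x, g x ∂ν : ℝ≥0∞) : EReal) := by
  have h : ∀ x, (-(g x : EReal)).toENNReal = 0 := fun x =>
    EReal.toENNReal_of_nonpos (by
      simpa using EReal.neg_le_neg_iff.2 (EReal.coe_ennreal_nonneg (g x)))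
  simp only [eintegral, h, EReal.toENNReal_coe, lintegral_zero, EReal.coe_ennreal_zero, sub_zero]

/-- The two integrands differ by `1 - f`, which has mean zero. Since `-(a log a) ≤ 1`, the negative
part is integrable and no `∞ - ∞` arises. -/
theorem eintegral_mul_log [IsProbabilityMeasure ν] (hf : Measurable f)
    (hf1 : ∫⁻ x, f x ∂ν = 1) :
    eintegral ν (fun x => (((f x).toReal * Real.log (f x).toReal : ℝ) : EReal))
      = ((∫⁻ x, klFunENN (f x) ∂ν : ℝ≥0∞) : EReal) := by
  set g : α → ℝ := fun x => (f x).toReal * Real.log (f x).toReal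
  have hg : Measurable g := by fun_prop
  have h1 : ∀ x, -g x ≤ 1 := fun x => by
    have h := klFun_nonneg (x := (f x).toReal) ENNReal.toReal_nonneg
    have h' : 0 ≤ (f x).toReal := ENNReal.toReal_nonneg
    rw [klFun_apply] at h
    simp only [g]
    linarith
  have hneg : ∫⁻ x, ENNReal.ofReal (-g x) ∂ν ≠ ∞ := by
    refine ((lintegral_mono fun x => ENNReal.ofReal_le_ofReal (h1 x)).trans_lt ?_).ne
    simp
  have h2 : ∫⁻ x, (ENNReal.ofReal (g x) + 1) ∂ν
      = ∫⁻ x, (klFunENN (f x) + ENNReal.ofReal (-g x) + f x) ∂ν := by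
    refine lintegral_congr_ae ?_
    filter_upwards [ae_lt_top hf (by simp [hf1])] with x hx
    have hk := klFun_nonneg (x := (f x).toReal) ENNReal.toReal_nonneg
    have e : klFun (f x).toReal = g x + 1 - (f x).toReal := klFun_apply _
    rw [klFunENN]
    conv_rhs => rw [← ENNReal.ofReal_toReal hx.ne]
    rw [ENNReal.toReal_ofReal ENNReal.toReal_nonneg, ← ENNReal.ofReal_one]
    rcases le_total 0 (g x) with h | h
    · rw [ENNReal.ofReal_of_nonpos (neg_nonpos.2 h), add_zero, ← ENNReal.ofReal_add h one_pos.le,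
        ← ENNReal.ofReal_add hk ENNReal.toReal_nonneg]
      congr 1; linarith
    · rw [ENNReal.ofReal_of_nonpos h, zero_add, ← ENNReal.ofReal_add hk (neg_nonneg.2 h),
        ← ENNReal.ofReal_add (add_nonneg hk (neg_nonneg.2 h)) ENNReal.toReal_nonneg]
      congr 1; linarith
  rw [lintegral_add_right _ (by fun_prop), lintegral_add_right _ hf,
    lintegral_add_left (by fun_prop), hf1] at h2
  simp only [lintegral_const, measure_univ, mul_one] at h2
  have h3 := (ENNReal.add_left_inj ENNReal.one_ne_top).1 h2
  simp only [eintegral, ← EReal.coe_neg, EReal.real_coe_toENNReal]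
  rw [h3, EReal.coe_ennreal_add]
  generalize ∫⁻ x, ENNReal.ofReal (-g x) ∂ν = m at hneg
  lift m to ℝ≥0 using hneg
  exact EReal.add_sub_cancel_right (b := (m : ℝ))

end Entropy

/-! ### The exponential law -/

theorem lintegral_holdingLaw (lam : Ioi (0 : ℝ)) {f : ℝ → ℝ≥0∞} (hf : Measurable f) :
    ∫⁻ s : HoldingTime, f s ∂holdingLaw lam
      = ∫⁻ s in Ioi (0 : ℝ), ENNReal.ofReal ((lam : ℝ) * Real.exp (-((lam : ℝ) * s))) * f s := by
  rw [holdingLaw, lintegral_withDensity_eq_lintegral_mul _ (by fun_prop) (by fun_prop)]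
  exact lintegral_subtype_comap measurableSet_Ioi
    (fun s => ENNReal.ofReal ((lam : ℝ) * Real.exp (-((lam : ℝ) * s))) * f s)

theorem holdingLaw_gt (lam : Ioi (0 : ℝ)) {r : ℝ} (hr : 0 ≤ r) :
    holdingLaw lam {s | r < (s : ℝ)} = ENNReal.ofReal (Real.exp (-((lam : ℝ) * r))) := by
  have hl : (0 : ℝ) < lam := lam.2
  have h := lintegral_holdingLaw lam (f := (Ioi r).indicator 1)
    (measurable_one.indicator measurableSet_Ioi)
  have h1 : ∫⁻ s : HoldingTime, (Ioi r).indicator (1 : ℝ → ℝ≥0∞) s ∂holdingLaw lam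
      = holdingLaw lam {s | r < (s : ℝ)} := by
    rw [← lintegral_indicator_one (measurableSet_lt measurable_const measurable_subtype_coe)]
    rfl
  rw [← h1, h]
  have h2 : ∀ s : ℝ, ENNReal.ofReal ((lam : ℝ) * Real.exp (-((lam : ℝ) * s)))
      * (Ioi r).indicator (1 : ℝ → ℝ≥0∞) s = (Ioi r).indicator
        (fun s => ENNReal.ofReal ((lam : ℝ) * Real.exp (-(lam : ℝ) * s))) s := fun s => by
    by_cases hs : s ∈ Ioi r <;> simp [hs]
  simp_rw [h2]
  rw [lintegral_indicator measurableSet_Ioi, Measure.restrict_restrict measurableSet_Ioi,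
    inter_eq_left.2 (Ioi_subset_Ioi hr), ← ofReal_integral_eq_lintegral_ofReal]
  · rw [integral_const_mul, integral_exp_mul_Ioi (by linarith) r]
    congr 1
    field_simp
  · exact (integrableOn_exp_mul_Ioi (by linarith) r).const_mul _
  · exact Eventually.of_forall fun t => by positivity

/-- The rate times the survival function is the exponential density. This is the compensator
identity for a single holding period that starts at time `j`. -/
theorem lintegral_exp_neg_sub (lam : Ioi (0 : ℝ)) {j : ℝ} (hj : 0 ≤ j) (t : ℝ) :
    ENNReal.ofReal (lam : ℝ) * ∫⁻ s in Icc 0 t, (Ici j).indicator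
        (fun s => ENNReal.ofReal (Real.exp (-((lam : ℝ) * (s - j))))) s
      = holdingLaw lam {r | j + (r : ℝ) ≤ t} := by
  have hl : (0 : ℝ) < lam := lam.2
  have h := lintegral_holdingLaw lam (f := {r | j + r ≤ t}.indicator 1)
    ((measurable_one).indicator (measurableSet_le (by fun_prop) (by fun_prop)))
  have h1 : ∫⁻ s : HoldingTime, {r | j + r ≤ t}.indicator (1 : ℝ → ℝ≥0∞) s ∂holdingLaw lam
      = holdingLaw lam {r | j + (r : ℝ) ≤ t} := by
    rw [← lintegral_indicator_one (measurableSet_le (by fun_prop) (by fun_prop))]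
    rfl
  rw [← h1, h, ← lintegral_const_mul' _ _ ENNReal.ofReal_ne_top,
    ← lintegral_indicator measurableSet_Icc, ← lintegral_indicator measurableSet_Ioi]
  refine Eq.trans ?_ (lintegral_sub_right_eq_self _ j)
  refine lintegral_congr_ae ?_
  -- After the shift by `j`, the two integrands can differ only at `s = j`, because holding times
  -- are strictly positive.
  filter_upwards [compl_mem_ae_iff.2 (measure_singleton (μ := volume) j)] with s hs
  have hs' : s ≠ j := hs
  simp only [indicator_apply, mem_Icc, mem_Ici, mem_Ioi, mem_ofPred_eq, Pi.one_apply, sub_pos]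
  by_cases h1 : j ≤ s
  · have h2 : j < s := lt_of_le_of_ne h1 (Ne.symm hs')
    have h3 : 0 ≤ s := hj.trans h1
    simp only [h1, h2, h3, if_true, true_and, add_sub_cancel, mul_ite, mul_one, mul_zero]
    rw [← ENNReal.ofReal_mul hl.le]
  · have h2 : ¬ j < s := fun h => h1 h.le
    simp [h1, h2]

end JumpProcess

namespace JumpProcess

variable {X : Type*}

/-! ### Jump counts of frozen paths -/

theorem jumpTime_zero (ω : Path X) : jumpTime 0 ω = 0 := by simp [jumpTime]

theorem jumpTime_nonneg (n : ℕ) (ω : Path X) : 0 ≤ jumpTime n ω :=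
  Finset.sum_nonneg fun k _ => (show (0 : ℝ) < (ω.1 k).2 from (ω.1 k).2.2).le

/-- The bound is `n + 1`, not `n`: `J_{n+1}` ends with `Δ_n`, which the state number `n` already
contains. Thus the time of the next jump is known before its target is drawn. -/
theorem jumpTime_freeze {k n : ℕ} (hk : k ≤ n + 1) (ω : Path X) :
    jumpTime k (freeze n ω) = jumpTime k ω := by
  refine Finset.sum_congr rfl fun i hi => ?_
  have : i < k := Finset.mem_range.1 hi
  simp only [freeze, freezeSeq, min_eq_left (show i ≤ n by omega)]

theorem jumpChain_freeze {k n : ℕ} (hk : k ≤ n) (ω : Path X) :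
    jumpChain k (freeze n ω) = jumpChain k ω := by
  simp only [jumpChain, freeze, freezeSeq, min_eq_left hk]

theorem freeze_freeze (m n : ℕ) (ω : Path X) :
    freeze m (freeze n ω) = freeze (min m n) ω := by
  refine Subtype.ext (funext fun k => ?_)
  simp only [freeze, freezeSeq, min_assoc]

theorem process_zero [MeasurableSpace X] (ω : Path X) : process 0 ω = jumpChain 0 ω := by
  have h : jumpCount 0 ω = 0 := by
    by_contra h
    have h1 := (jumpTime_le_iff le_rfl 1 ω).2 (Nat.one_le_iff_ne_zero.2 h)
    have h2 := strictMono_jumpTime ω zero_lt_one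
    simp only [jumpTime_zero] at h2
    linarith
  rw [process, h]

variable [MeasurableSpace X]

theorem jumpCount_eq_iff {t : ℝ} (ht : 0 ≤ t) (n : ℕ) (ω : Path X) :
    jumpCount t ω = n ↔ jumpTime n ω ≤ t ∧ t < jumpTime (n + 1) ω := by
  rw [← not_le, jumpTime_le_iff ht, jumpTime_le_iff ht]
  omega

theorem jumpCount_jumpTime (n : ℕ) (ω : Path X) : jumpCount (jumpTime n ω) ω = n :=
  (jumpCount_eq_iff (jumpTime_nonneg n ω) n ω).2
    ⟨le_rfl, strictMono_jumpTime ω (Nat.lt_succ_self n)⟩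

theorem process_jumpTime (n : ℕ) (ω : Path X) : process (jumpTime n ω) ω = jumpChain n ω := by
  rw [process, jumpCount_jumpTime]

theorem jumpCount_mono {s t : ℝ} (hs : 0 ≤ s) (hst : s ≤ t) (ω : Path X) :
    jumpCount s ω ≤ jumpCount t ω :=
  (jumpTime_le_iff (hs.trans hst) _ ω).1 ((jumpTime_jumpCount_le hs ω).1.trans hst)

theorem jumpCount_freeze_eq_iff {t : ℝ} (ht : 0 ≤ t) (n : ℕ) (ω : Path X) :
    jumpCount t (freeze n ω) = n ↔ jumpCount t ω = n := by
  rw [jumpCount_eq_iff ht, jumpCount_eq_iff ht, jumpTime_freeze (Nat.le_succ n),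
    jumpTime_freeze le_rfl]

theorem jumpCount_freeze {s t : ℝ} (hs : 0 ≤ s) (hst : s ≤ t) (ω : Path X) :
    jumpCount s (freeze (jumpCount t ω) ω) = jumpCount s ω := by
  have h := jumpCount_mono hs hst ω
  rw [jumpCount_eq_iff hs, jumpTime_freeze (by omega), jumpTime_freeze (by omega)]
  exact jumpTime_jumpCount_le hs ω

theorem process_freeze {s t : ℝ} (hs : 0 ≤ s) (hst : s ≤ t) (ω : Path X) :
    process s (freeze (jumpCount t ω) ω) = process s ω := by
  rw [process, jumpCount_freeze hs hst, jumpChain_freeze (jumpCount_mono hs hst ω), process]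

theorem jumpTime_le_freeze {s t : ℝ} (hs : 0 ≤ s) (hst : s ≤ t) (n : ℕ) (ω : Path X) :
    jumpTime n (freeze (jumpCount t ω) ω) ≤ s ↔ jumpTime n ω ≤ s := by
  rw [jumpTime_le_iff hs, jumpTime_le_iff hs, jumpCount_freeze hs hst]

theorem min_jumpTime_freeze {s t : ℝ} (hs : 0 ≤ s) (hst : s ≤ t) (n : ℕ) (ω : Path X) :
    min (jumpTime n (freeze (jumpCount t ω) ω)) s = min (jumpTime n ω) s := by
  by_cases h : jumpTime n ω ≤ s
  · rw [jumpTime_freeze]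
    have := (jumpTime_le_iff (hs.trans hst) n ω).1 (h.trans hst)
    omega
  · have h' := h
    rw [← jumpTime_le_freeze hs hst] at h'
    rw [min_eq_right (not_le.1 h).le, min_eq_right (not_le.1 h').le]

@[fun_prop]
theorem measurable_jumpCount (t : ℝ) : Measurable (jumpCount (X := X) t) := by
  classical
  exact measurable_find _ fun n => measurableSet_lt measurable_const (measurable_jumpTime _)

/-! ### The law of the jump chain and the compensator of the jump counts -/

variable (lam : Ioi (0 : ℝ)) (p : Kernel X X) [IsMarkovKernel p] (π : Measure X)
  [IsProbabilityMeasure π]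

theorem map_jumpChain_pathMeasure (n : ℕ) :
    (pathMeasure lam p π).map (jumpChain n) = (fun ν => ν.bind p)^[n] π := by
  induction n with
  | zero =>
    refine Measure.ext_of_lintegral _ fun f hf => ?_
    rw [lintegral_map hf (by fun_prop), lintegral_pathMeasure_zero lam p π
      (G := fun x _ => f x) (by exact hf.comp measurable_fst)]
    simp
  | succ n ih =>
    refine Measure.ext_of_lintegral _ fun f hf => ?_
    rw [Function.iterate_succ_apply', ← ih, lintegral_map hf (by fun_prop),
      lintegral_pathMeasure_succ lam p π n (G := fun _ x _ => f x) (by fun_prop) fun _ => rfl,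
      Measure.lintegral_bind p.aemeasurable hf.aemeasurable,
      lintegral_map hf.lintegral_kernel (by fun_prop)]
    simp

/-- The holding time in the state number `n` is independent of the past and of that state. -/
theorem lintegral_holdingTime (n : ℕ) {G : ℝ → X → HoldingTime → ℝ≥0∞}
    (hG : Measurable fun y : ℝ × X × HoldingTime => G y.1 y.2.1 y.2.2) :
    ∫⁻ ω, G (jumpTime n ω) (jumpChain n ω) (holdingTime n ω) ∂pathMeasure lam p π
      = ∫⁻ ω, ∫⁻ r, G (jumpTime n ω) (jumpChain n ω) r ∂holdingLaw lam ∂pathMeasure lam p π := by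
  rcases n with _ | n
  · simp only [jumpTime_zero]
    have hG0 : Measurable fun y : X × HoldingTime => G 0 y.1 y.2 := by fun_prop
    rw [lintegral_pathMeasure_zero lam p π (G := G 0) hG0, lintegral_pathMeasure_zero lam p π
      (G := fun x _ => ∫⁻ r, G 0 x r ∂holdingLaw lam)
      (by exact (hG0.lintegral_prod_right' (ν := holdingLaw lam)).comp measurable_fst)]
    simp
  · have hm : Measurable fun y : ℝ × X => ∫⁻ r, G y.1 y.2 r ∂holdingLaw lam :=
      Measurable.lintegral_prod_right' (f := fun y : (ℝ × X) × HoldingTime => G y.1.1 y.1.2 y.2)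
        (by fun_prop)
    rw [lintegral_pathMeasure_succ lam p π n
        (G := fun ω x r => G (jumpTime (n + 1) ω) x r) (by fun_prop)
        (fun ω => by simp only [jumpTime_freeze le_rfl]),
      lintegral_pathMeasure_succ lam p π n
        (G := fun ω x _ => ∫⁻ r, G (jumpTime (n + 1) ω) x r ∂holdingLaw lam) (by fun_prop)
        (fun ω => by simp only [jumpTime_freeze le_rfl])]
    simp

theorem process_eq_tsum {s : ℝ} (hs : 0 ≤ s) (g : X → ℝ≥0∞) (ω : Path X) :
    g (process s ω) = ∑' k, if jumpTime k ω ≤ s ∧ s < jumpTime k ω + holdingTime k ω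
      then g (jumpChain k ω) else 0 := by
  simp only [← jumpTime_succ, ← jumpCount_eq_iff hs]
  rw [tsum_eq_single (jumpCount s ω) (fun k hk => if_neg hk.symm), if_pos rfl, process]

/-- The path is cut into its holding intervals. Integrating out `Δ_k` leaves the probability that
the state entered at `J_k` still survives at time `s`. -/
theorem lintegral_process {s : ℝ} (hs : 0 ≤ s) {g : X → ℝ≥0∞} (hg : Measurable g) :
    ∫⁻ ω, g (process s ω) ∂pathMeasure lam p π = ∑' k, ∫⁻ ω, g (jumpChain k ω) *
      (Ici (jumpTime k ω)).indicator (fun s =>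
        ENNReal.ofReal (Real.exp (-((lam : ℝ) * (s - jumpTime k ω))))) s ∂pathMeasure lam p π := by
  simp_rw [process_eq_tsum hs]
  have hm : Measurable fun y : ℝ × X × HoldingTime =>
      if y.1 ≤ s ∧ s < y.1 + y.2.2 then g y.2.1 else 0 :=
    Measurable.ite ((measurableSet_le (f := fun y : ℝ × X × HoldingTime => y.1)
      (g := fun _ => s) (by fun_prop) (by fun_prop)).inter
      (measurableSet_lt (f := fun _ : ℝ × X × HoldingTime => s)
        (g := fun y => y.1 + y.2.2) (by fun_prop) (by fun_prop))) (by fun_prop) (by fun_prop)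
  have hm' : ∀ k, Measurable fun ω : Path X =>
      if jumpTime k ω ≤ s ∧ s < jumpTime k ω + holdingTime k ω then g (jumpChain k ω) else 0 :=
    fun k => hm.comp (show Measurable fun ω : Path X =>
      (jumpTime k ω, jumpChain k ω, holdingTime k ω) by fun_prop)
  rw [lintegral_tsum fun k => (hm' k).aemeasurable]
  refine tsum_congr fun k => ?_
  rw [lintegral_holdingTime lam p π k (G := fun j x r => if j ≤ s ∧ s < j + r then g x else 0) hm]
  refine lintegral_congr fun ω => ?_
  by_cases h : jumpTime k ω ≤ s
  · have h1 : ∀ r : HoldingTime, (if jumpTime k ω ≤ s ∧ s < jumpTime k ω + r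
        then g (jumpChain k ω) else 0) = g (jumpChain k ω) *
          {r : HoldingTime | s - jumpTime k ω < (r : ℝ)}.indicator 1 r := fun r => by
      simp [h, indicator_apply, sub_lt_iff_lt_add']
    simp_rw [h1]
    have hms : MeasurableSet {r : HoldingTime | s - jumpTime k ω < (r : ℝ)} :=
      measurableSet_lt measurable_const measurable_subtype_coe
    rw [lintegral_const_mul _ (measurable_one.indicator hms), lintegral_indicator_one hms,
      holdingLaw_gt lam (sub_nonneg.2 h), indicator_of_mem (by exact h)]
  · simp [h]

/-- The intensity of the jumps is `lam`. -/
theorem tsum_lintegral_jumpTime_le (t : ℝ) {g : X → ℝ≥0∞} (hg : Measurable g) :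
    ∑' k, ∫⁻ ω, (if jumpTime (k + 1) ω ≤ t then g (jumpChain k ω) else 0) ∂pathMeasure lam p π
      = ENNReal.ofReal lam *
        ∫⁻ s in Icc 0 t, ∫⁻ ω, g (process s ω) ∂pathMeasure lam p π := by
  have hm : ∀ k, Measurable fun y : ℝ × Path X => g (jumpChain k y.2) *
      (Ici (jumpTime k y.2)).indicator (fun s =>
        ENNReal.ofReal (Real.exp (-((lam : ℝ) * (s - jumpTime k y.2))))) y.1 := fun k => by
    refine Measurable.mul (by fun_prop) ?_
    exact Measurable.ite (measurableSet_le (f := fun y : ℝ × Path X => jumpTime k y.2)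
      (g := fun y : ℝ × Path X => y.1) (by fun_prop) (by fun_prop)) (by fun_prop) (by fun_prop)
  rw [setLIntegral_congr_fun measurableSet_Icc
    (fun s hs => lintegral_process lam p π hs.1 hg),
    lintegral_tsum fun k => ((hm k).lintegral_prod_right' (ν := pathMeasure lam p π)).aemeasurable,
    ← ENNReal.tsum_mul_left]
  refine tsum_congr fun k => ?_
  rw [lintegral_lintegral_swap (hm k).aemeasurable, ← lintegral_const_mul' _ _
    ENNReal.ofReal_ne_top]
  have hG : Measurable fun y : ℝ × X × HoldingTime => if y.1 + y.2.2 ≤ t then g y.2.1 else 0 :=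
    Measurable.ite (measurableSet_le (by fun_prop) (by fun_prop)) (by fun_prop) (by fun_prop)
  simp only [jumpTime_succ]
  rw [lintegral_holdingTime lam p π k (G := fun j x r => if j + r ≤ t then g x else 0) hG]
  refine lintegral_congr fun ω => ?_
  have hms : MeasurableSet {r : HoldingTime | jumpTime k ω + (r : ℝ) ≤ t} :=
    measurableSet_le (by fun_prop) (by fun_prop)
  rw [lintegral_const_mul _ (by
      refine Measurable.indicator (by fun_prop) measurableSet_Ici), mul_left_comm,
    lintegral_exp_neg_sub lam (jumpTime_nonneg k ω) t, ← lintegral_indicator_one hms,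
    ← lintegral_const_mul _ (measurable_one.indicator hms)]
  refine lintegral_congr fun r => ?_
  simp [indicator_apply]

/-- Under an invariant initial law, the jump chain is stationary and independent of the jump
times. -/
theorem lintegral_jumpChain_jumpTime_of_invariant (hπ : Kernel.Invariant p π) (n : ℕ)
    {g : X → ℝ≥0∞} (hg : Measurable g) {φ : ℝ → ℝ≥0∞} (hφ : Measurable φ) :
    ∫⁻ ω, g (jumpChain n ω) * φ (jumpTime n ω) ∂pathMeasure lam p π
      = (∫⁻ x, g x ∂π) * ∫⁻ ω, φ (jumpTime n ω) ∂pathMeasure lam p π := by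
  induction n generalizing g φ with
  | zero =>
    simp only [jumpTime_zero]
    rw [lintegral_mul_const _ (by fun_prop), lintegral_pathMeasure_zero lam p π
      (G := fun x _ => g x) (by exact hg.comp measurable_fst)]
    simp
  | succ n ih =>
    -- `J_{n+1}` reads only the states up to `n`, so the new state is integrated out first, which
    -- replaces `g` by `x ↦ ∫ g dp(x)`. Integrating out `Δ_n` then brings back the form of the
    -- induction hypothesis, and invariance restores `∫ g dπ`.
    have h1 : ∫⁻ ω, g (jumpChain (n + 1) ω) * φ (jumpTime (n + 1) ω) ∂pathMeasure lam p π
        = ∫⁻ ω, (∫⁻ y, g y ∂p (jumpChain n ω)) * φ (jumpTime (n + 1) ω)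
          ∂pathMeasure lam p π := by
      rw [lintegral_pathMeasure_succ lam p π n
        (G := fun ω x _ => g x * φ (jumpTime (n + 1) ω)) (by fun_prop)
        (fun ω => by simp only [jumpTime_freeze le_rfl])]
      refine lintegral_congr fun ω => ?_
      simp [lintegral_mul_const _ hg]
    have hpg : Measurable fun x => ∫⁻ y, g y ∂p x := hg.lintegral_kernel
    have hφ' : Measurable fun j : ℝ => ∫⁻ r : HoldingTime, φ (j + r) ∂holdingLaw lam :=
      Measurable.lintegral_prod_right' (f := fun y : ℝ × HoldingTime => φ (y.1 + y.2))
        (by fun_prop)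
    have h2 := lintegral_holdingTime lam p π n
      (G := fun j x r => (∫⁻ y, g y ∂p x) * φ (j + r)) (by fun_prop)
    have h3 := lintegral_holdingTime lam p π n (G := fun j _ r => φ (j + r)) (by fun_prop)
    simp only [← jumpTime_succ] at h2 h3
    rw [h1, h2, h3, ← lintegral_congr fun ω => (lintegral_const_mul _ (by fun_prop)).symm,
      ih hpg hφ', ← Measure.lintegral_bind p.aemeasurable hg.aemeasurable, hπ.def]

theorem tsum_lintegral_jumpTime_le_of_invariant (hπ : Kernel.Invariant p π) (t : ℝ)
    {g : X → ℝ≥0∞} (hg : Measurable g) :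
    ∑' k, ∫⁻ ω, (if jumpTime (k + 1) ω ≤ t then g (jumpChain k ω) else 0) ∂pathMeasure lam p π
      = ENNReal.ofReal (lam * t) * ∫⁻ x, g x ∂π := by
  have h1 : ∀ (g : X → ℝ≥0∞) (_ : Measurable g) (k : ℕ),
      ∫⁻ ω, (if jumpTime (k + 1) ω ≤ t then g (jumpChain k ω) else 0) ∂pathMeasure lam p π
        = (∫⁻ x, g x ∂π) * ∫⁻ ω, holdingLaw lam {r | jumpTime k ω + (r : ℝ) ≤ t}
            ∂pathMeasure lam p π := fun g hg k => by
    have hG : Measurable fun y : ℝ × X × HoldingTime => if y.1 + y.2.2 ≤ t then g y.2.1 else 0 :=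
      Measurable.ite (measurableSet_le (by fun_prop) (by fun_prop)) (by fun_prop) (by fun_prop)
    have hφ : Measurable fun j : ℝ => holdingLaw lam {r | j + (r : ℝ) ≤ t} :=
      measurable_measure_prodMk_left (s := {y : ℝ × HoldingTime | y.1 + y.2 ≤ t})
        (measurableSet_le (by fun_prop) (by fun_prop))
    simp only [jumpTime_succ]
    rw [lintegral_holdingTime lam p π k (G := fun j x r => if j + r ≤ t then g x else 0) hG,
      ← lintegral_jumpChain_jumpTime_of_invariant lam p π hπ k hg hφ]
    refine lintegral_congr fun ω => ?_
    have hms : MeasurableSet {r : HoldingTime | jumpTime k ω + (r : ℝ) ≤ t} :=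
      measurableSet_le (by fun_prop) (by fun_prop)
    rw [← lintegral_indicator_one hms, ← lintegral_const_mul _ (measurable_one.indicator hms)]
    refine lintegral_congr fun r => ?_
    simp [indicator_apply]
  -- With `g = 1` the compensator identity gives the expected number of jumps as `lam * t`, so the
  -- Poisson law is not needed.
  have h2 := tsum_lintegral_jumpTime_le lam p π t (g := fun _ => 1) measurable_const
  simp only [lintegral_const, measure_univ, mul_one, Measure.restrict_apply_univ,
    Real.volume_Icc, sub_zero, one_mul] at h2
  simp_rw [h1 g hg, ENNReal.tsum_mul_left]
  rw [ENNReal.ofReal_mul (le_of_lt lam.2), mul_comm, ← h2]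
  congr 1
  refine tsum_congr fun k => ?_
  rw [h1 (fun _ => 1) measurable_const k]
  simp

end JumpProcess

namespace JumpProcess

variable {X : Type*}

/-! ### Gluing a state to a frozen path -/

/-- The path that follows `ω` up to its state number `n` and then stays at `z`. -/
def glue (n : ℕ) (ω : Path X) (z : X × HoldingTime) : Path X :=
  ⟨fun k => if k ≤ n then ω.1 k else z, by
    have h := freezeSeq_mem_explosionFree (n + 1) fun k => if k ≤ n then ω.1 k else z
    convert h using 1
    ext1 k
    by_cases hk : k ≤ n
    · simp [freezeSeq, hk, show k ≤ n + 1 by omega]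
    · simp [freezeSeq, hk, show n + 1 ≤ k by omega]⟩

/-- The path with all its states equal to `z`. -/
def constPath (z : X × HoldingTime) : Path X :=
  ⟨fun _ => z, freezeSeq_mem_explosionFree 0 fun _ => z⟩

theorem glue_freeze (n : ℕ) (ω : Path X) (z : X × HoldingTime) :
    glue n (freeze n ω) z = glue n ω z := by
  refine Subtype.ext (funext fun k => ?_)
  by_cases hk : k ≤ n <;> simp [glue, freeze, freezeSeq, hk]

/-- This writes a function of the states `0, …, n + 1` as a function of the past and the new state,
the form required by the Markov property. -/
theorem freeze_succ_eq_glue (n : ℕ) (ω : Path X) :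
    freeze (n + 1) ω = glue n ω (jumpChain (n + 1) ω, holdingTime (n + 1) ω) := by
  refine Subtype.ext (funext fun k => ?_)
  by_cases hk : k ≤ n
  · simp [glue, freeze, freezeSeq, hk, show k ≤ n + 1 by omega]
  · simp [glue, freeze, freezeSeq, hk, show n + 1 ≤ k by omega, jumpChain, holdingTime]

theorem freeze_zero_eq_constPath (ω : Path X) :
    freeze 0 ω = constPath (jumpChain 0 ω, holdingTime 0 ω) := by
  refine Subtype.ext (funext fun k => ?_)
  simp [constPath, freeze, freezeSeq, jumpChain, holdingTime]

variable [MeasurableSpace X]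

@[fun_prop]
theorem measurable_glue (n : ℕ) :
    Measurable fun y : Path X × X × HoldingTime => glue n y.1 y.2 := by
  refine Measurable.subtype_mk (measurable_pi_lambda _ fun k => ?_)
  by_cases hk : k ≤ n
  · simp only [hk, if_true]
    exact (measurable_pi_apply k).comp (measurable_subtype_coe.comp measurable_fst)
  · simp only [hk, if_false]
    exact measurable_snd

@[fun_prop]
theorem measurable_constPath : Measurable (constPath (X := X)) :=
  Measurable.subtype_mk (measurable_pi_lambda _ fun _ => measurable_id)

/-! ### Change of measure -/

/-- The density of the law of the first `n + 1` states. -/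
noncomputable def chainDensity (μ' μ : Measure X) (h : X → X → ℝ≥0∞) (n : ℕ) (ω : Path X) :
    ℝ≥0∞ :=
  μ'.rnDeriv μ (jumpChain 0 ω) *
    ∏ k ∈ Finset.range n, h (jumpChain k ω) (jumpChain (k + 1) ω)

/-- `h` is a density of `p'` with respect to `p` at almost all states that the jump chain
visits. -/
structure IsTransitionDensity (lam : Ioi (0 : ℝ)) (p' p : Kernel X X) [IsMarkovKernel p']
    (μ' μ : Measure X) (h : X → X → ℝ≥0∞) : Prop where
  absolutelyContinuous : μ' ≪ μ
  measurable : Measurable (Function.uncurry h)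
  exists_null_set : ∃ B, MeasurableSet B ∧ (∀ x ∉ B, p' x = (p x).withDensity (h x)) ∧
    ∀ n, ∀ᵐ ω ∂pathMeasure lam p' μ', jumpChain n ω ∉ B

theorem chainDensity_succ (μ' μ : Measure X) (h : X → X → ℝ≥0∞) (n : ℕ) (ω : Path X) :
    chainDensity μ' μ h (n + 1) ω
      = chainDensity μ' μ h n ω * h (jumpChain n ω) (jumpChain (n + 1) ω) := by
  rw [chainDensity, Finset.prod_range_succ, ← mul_assoc, chainDensity]

theorem chainDensity_freeze (μ' μ : Measure X) (h : X → X → ℝ≥0∞) {m n : ℕ} (hmn : m ≤ n)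
    (ω : Path X) : chainDensity μ' μ h m (freeze n ω) = chainDensity μ' μ h m ω := by
  rw [chainDensity, jumpChain_freeze n.zero_le, chainDensity]
  congr 1
  refine Finset.prod_congr rfl fun k hk => ?_
  have := Finset.mem_range.1 hk
  rw [jumpChain_freeze (by omega), jumpChain_freeze (by omega)]

theorem measurable_chainDensity (μ' μ : Measure X) {h : X → X → ℝ≥0∞}
    (hh : Measurable (Function.uncurry h)) (n : ℕ) : Measurable (chainDensity μ' μ h n) := by
  unfold chainDensity
  fun_prop

variable {lam : Ioi (0 : ℝ)} {p' p : Kernel X X} [IsMarkovKernel p'] [IsMarkovKernel p]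
  {μ' μ : Measure X} [IsProbabilityMeasure μ'] [IsProbabilityMeasure μ] {h : X → X → ℝ≥0∞}

omit [IsMarkovKernel p] [IsProbabilityMeasure μ] in
-- The iterates of `μ'` are the laws of the jump chain, so a `μ'`-null exceptional set is almost
-- surely never visited. A measurable hull is taken because the set itself need not be measurable.
theorem IsTransitionDensity.of_ae (hac : μ' ≪ μ) (hh : Measurable (Function.uncurry h))
    (hd : ∀ᵐ x ∂μ', p' x = (p x).withDensity (h x))
    (hit : ∀ n : ℕ, (fun ν => ν.bind p')^[n] μ' ≪ μ') :
    IsTransitionDensity lam p' p μ' μ h := by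
  refine ⟨hac, hh, toMeasurable μ' {x | ¬ p' x = (p x).withDensity (h x)},
    measurableSet_toMeasurable _ _, fun x hx => ?_, fun n => ?_⟩
  · by_contra hne
    exact hx (subset_toMeasurable _ _ hne)
  · have h0 : μ' (toMeasurable μ' {x | ¬ p' x = (p x).withDensity (h x)}) = 0 := by
      rw [measure_toMeasurable]; exact hd
    have h1 := hit n h0
    rw [← map_jumpChain_pathMeasure lam p' μ' n,
      Measure.map_apply (measurable_jumpChain n) (measurableSet_toMeasurable _ _)] at h1
    exact compl_mem_ae_iff.2 h1

theorem lintegral_rnDeriv_mul' (hac : μ' ≪ μ) {f : X → ℝ≥0∞} (hf : Measurable f) :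
    ∫⁻ x, f x ∂μ' = ∫⁻ x, μ'.rnDeriv μ x * f x ∂μ := by
  conv_lhs => rw [← Measure.withDensity_rnDeriv_eq _ _ hac]
  rw [lintegral_withDensity_eq_lintegral_mul _ (Measure.measurable_rnDeriv _ _) hf]
  rfl

namespace IsTransitionDensity

/-- Change of measure for functions of the first `n + 1` states. -/
theorem lintegral_eq (hd : IsTransitionDensity lam p' p μ' μ h) (n : ℕ) {F : Path X → ℝ≥0∞}
    (hF : Measurable F) (hFn : ∀ ω, F (freeze n ω) = F ω) :
    ∫⁻ ω, F ω ∂pathMeasure lam p' μ'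
      = ∫⁻ ω, chainDensity μ' μ h n ω * F ω ∂pathMeasure lam p μ := by
  obtain ⟨hac, hh, B, -, hB, hB'⟩ := hd
  induction n generalizing F with
  | zero =>
    have hm : Measurable fun y : X × HoldingTime => F (constPath (y.1, y.2)) := by fun_prop
    have e : ∀ ω, F ω = F (constPath (jumpChain 0 ω, holdingTime 0 ω)) := fun ω => by
      rw [← freeze_zero_eq_constPath, hFn]
    simp_rw [chainDensity, Finset.range_zero, Finset.prod_empty, mul_one]
    rw [lintegral_congr e, lintegral_congr fun ω => congrArg (_ * ·) (e ω),
      lintegral_pathMeasure_zero lam p' μ' (G := fun x r => F (constPath (x, r))) hm,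
      lintegral_pathMeasure_zero lam p μ (G := fun x r => μ'.rnDeriv μ x * F (constPath (x, r)))
        (((Measure.measurable_rnDeriv μ' μ).comp measurable_fst).mul hm),
      lintegral_rnDeriv_mul' hac (hm.lintegral_prod_right' (ν := holdingLaw lam))]
    refine lintegral_congr fun x => ?_
    rw [lintegral_const_mul _ (by fun_prop)]
  | succ n ih =>
    have e : ∀ ω, F ω = F (glue n ω (jumpChain (n + 1) ω, holdingTime (n + 1) ω)) := fun ω => by
      rw [← freeze_succ_eq_glue, hFn]
    have hm : Measurable fun y : Path X × X × HoldingTime => F (glue n y.1 (y.2.1, y.2.2)) := by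
      fun_prop
    have hm1 : Measurable fun y : Path X × X =>
        ∫⁻ r, F (glue n y.1 (y.2, r)) ∂holdingLaw lam :=
      Measurable.lintegral_prod_right'
        (f := fun y : (Path X × X) × HoldingTime => F (glue n y.1.1 (y.1.2, y.2))) (by fun_prop)
    have hm2 : Measurable fun y : Path X × X => h (jumpChain n y.1) y.2 *
        ∫⁻ r, F (glue n y.1 (y.2, r)) ∂holdingLaw lam :=
      (hh.comp (show Measurable fun y : Path X × X => (jumpChain n y.1, y.2) by fun_prop)).mul hm1
    have hmF : Measurable fun ω : Path X => ∫⁻ x, h (jumpChain n ω) x *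
        ∫⁻ r, F (glue n ω (x, r)) ∂holdingLaw lam ∂p (jumpChain n ω) :=
      hm2.lintegral_kernel_prod_right' (κ := p.comap (jumpChain n) (measurable_jumpChain n))
    have hmM := measurable_chainDensity μ' μ hh n
    rw [lintegral_congr e, lintegral_congr fun ω => congrArg (_ * ·) (e ω),
      lintegral_pathMeasure_succ lam p' μ' n (G := fun ω x r => F (glue n ω (x, r))) hm
        (fun ω => by simp only [glue_freeze])]
    simp_rw [chainDensity_succ]
    rw [lintegral_pathMeasure_succ lam p μ n (G := fun ω x r => chainDensity μ' μ h n ω *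
        h (jumpChain n ω) x * F (glue n ω (x, r)))
      (((hmM.comp measurable_fst).mul (hh.comp
        (show Measurable fun y : Path X × X × HoldingTime => (jumpChain n y.1, y.2.1) by
          fun_prop))).mul hm)
      (fun ω => by
        simp only [glue_freeze, chainDensity_freeze μ' μ h le_rfl, jumpChain_freeze le_rfl])]
    have hae : ∀ᵐ ω ∂pathMeasure lam p' μ',
        ∫⁻ x, ∫⁻ r, F (glue n ω (x, r)) ∂holdingLaw lam ∂p' (jumpChain n ω)
          = ∫⁻ x, h (jumpChain n ω) x *
            ∫⁻ r, F (glue n ω (x, r)) ∂holdingLaw lam ∂p (jumpChain n ω) := by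
      filter_upwards [hB' n] with ω hω
      have hm1' : Measurable fun x => ∫⁻ r, F (glue n ω (x, r)) ∂holdingLaw lam :=
        hm1.comp measurable_prodMk_left
      rw [hB _ hω, lintegral_withDensity_eq_lintegral_mul _ hh.of_uncurry_left hm1']
      rfl
    rw [lintegral_congr_ae hae, ih hmF fun ω => by
      simp only [glue_freeze, jumpChain_freeze le_rfl]]
    refine lintegral_congr fun ω => ?_
    have hm2' : Measurable fun x => h (jumpChain n ω) x *
        ∫⁻ r, F (glue n ω (x, r)) ∂holdingLaw lam := hm2.comp measurable_prodMk_left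
    rw [← lintegral_const_mul _ hm2']
    refine lintegral_congr fun x => ?_
    rw [← mul_assoc, ← lintegral_const_mul _ (by fun_prop)]

theorem lintegral_chainDensity (hd : IsTransitionDensity lam p' p μ' μ h) (n : ℕ) :
    ∫⁻ ω, chainDensity μ' μ h n ω ∂pathMeasure lam p μ = 1 := by
  simpa using (hd.lintegral_eq n (F := fun _ => 1) measurable_const fun _ => rfl).symm

/-- On the support of the density, `h` is a density at the states of the jump chain. -/
theorem ae_withDensity_eq (hd : IsTransitionDensity lam p' p μ' μ h) (n : ℕ) :
    ∀ᵐ ω ∂pathMeasure lam p μ, chainDensity μ' μ h n ω = 0 ∨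
      p' (jumpChain n ω) = (p (jumpChain n ω)).withDensity (h (jumpChain n ω)) := by
  obtain ⟨B, hBm, hB, hB'⟩ := hd.exists_null_set
  have hm : Measurable fun ω : Path X => B.indicator (1 : X → ℝ≥0∞) (jumpChain n ω) :=
    (measurable_one.indicator hBm).comp (measurable_jumpChain n)
  have h1 := hd.lintegral_eq n hm fun ω => by rw [jumpChain_freeze le_rfl]
  have h2 : ∫⁻ ω, B.indicator (1 : X → ℝ≥0∞) (jumpChain n ω) ∂pathMeasure lam p' μ' = 0 := by
    rw [lintegral_eq_zero_iff hm]
    filter_upwards [hB' n] with ω hω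
    simp [hω]
  rw [h2, eq_comm, lintegral_eq_zero_iff ((measurable_chainDensity μ' μ hd.measurable n).fun_mul
    hm)] at h1
  filter_upwards [h1] with ω hω
  rcases mul_eq_zero.1 hω with h3 | h3
  · exact Or.inl h3
  · exact Or.inr (hB _ fun hmem => by simp [hmem] at h3)

end IsTransitionDensity

/-! ### Stopping -/

/-- A random number of steps that is determined by the states that precede it. -/
structure IsStopIndex (τ : Path X → ℕ) : Prop where
  measurable : Measurable τ
  freeze_eq_iff : ∀ n ω, τ (freeze n ω) = n ↔ τ ω = n

/-- The path frozen at its state number `τ`. -/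
def stopAt (τ : Path X → ℕ) (ω : Path X) : Path X := freeze (τ ω) ω

theorem isStopIndex_jumpCount {t : ℝ} (ht : 0 ≤ t) : IsStopIndex (jumpCount (X := X) t) :=
  ⟨measurable_jumpCount t, jumpCount_freeze_eq_iff ht⟩

theorem isStopIndex_min_jumpCount {t : ℝ} (ht : 0 ≤ t) (m : ℕ) :
    IsStopIndex fun ω : Path X => min (jumpCount t ω) m := by
  refine ⟨(measurable_jumpCount t).min measurable_const, fun n ω => ?_⟩
  rcases lt_trichotomy n m with hn | rfl | hn
  · have e : ∀ k, min k m = n ↔ k = n := fun k => by omega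
    rw [e, e, jumpCount_freeze_eq_iff ht]
  -- At the cap the event is only `J_m ≤ t`, which reads the states before number `m`.
  · rw [min_eq_right_iff, min_eq_right_iff, ← jumpTime_le_iff ht, ← jumpTime_le_iff ht,
      jumpTime_freeze (Nat.le_succ n)]
  · have e : ∀ k, ¬ min k m = n := fun k => by omega
    simp [e]

namespace IsStopIndex

variable {τ : Path X → ℕ}

theorem apply_stopAt (hτ : IsStopIndex τ) (ω : Path X) : τ (stopAt τ ω) = τ ω :=
  (hτ.freeze_eq_iff (τ ω) ω).2 rfl

theorem stopAt_stopAt (hτ : IsStopIndex τ) (ω : Path X) :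
    stopAt τ (stopAt τ ω) = stopAt τ ω := by
  rw [stopAt, hτ.apply_stopAt, stopAt, freeze_freeze, min_self]

theorem measurable_stopAt (hτ : IsStopIndex τ) : Measurable (stopAt τ) := by
  have h : Measurable fun y : ℕ × Path X => freeze y.1 y.2 :=
    measurable_from_prod_countable_right fun n => measurable_freeze n
  exact h.comp (hτ.measurable.prodMk measurable_id)

theorem chainDensity_stopAt (hτ : IsStopIndex τ) (μ' μ : Measure X) (h : X → X → ℝ≥0∞)
    (ω : Path X) :
    chainDensity μ' μ h (τ (stopAt τ ω)) (stopAt τ ω) = chainDensity μ' μ h (τ ω) ω := by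
  rw [hτ.apply_stopAt, stopAt, chainDensity_freeze μ' μ h le_rfl]

theorem measurable_chainDensity (hτ : IsStopIndex τ) (μ' μ : Measure X) {h : X → X → ℝ≥0∞}
    (hh : Measurable (Function.uncurry h)) :
    Measurable fun ω => chainDensity μ' μ h (τ ω) ω := by
  have h1 : Measurable fun y : ℕ × Path X => chainDensity μ' μ h y.1 y.2 :=
    measurable_from_prod_countable_right fun n => JumpProcess.measurable_chainDensity μ' μ hh n
  exact h1.comp (hτ.measurable.prodMk measurable_id)

/-- Change of measure for functions of the stopped path. -/
theorem lintegral_eq (hτ : IsStopIndex τ) (hd : IsTransitionDensity lam p' p μ' μ h)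
    {F : Path X → ℝ≥0∞} (hF : Measurable F) (hFτ : ∀ ω, F (stopAt τ ω) = F ω) :
    ∫⁻ ω, F ω ∂pathMeasure lam p' μ'
      = ∫⁻ ω, chainDensity μ' μ h (τ ω) ω * F ω ∂pathMeasure lam p μ := by
  have e : ∀ G : ℕ → Path X → ℝ≥0∞, ∀ ω, G (τ ω) ω = ∑' n, (τ ⁻¹' {n}).indicator (G n) ω :=
    fun G ω => by
      rw [tsum_eq_single (τ ω) fun n hn => indicator_of_notMem (by simpa using hn.symm) _]
      simp
  have hs : ∀ n, MeasurableSet (τ ⁻¹' {n}) := fun n => hτ.measurable (measurableSet_singleton n)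
  have hM := fun n => JumpProcess.measurable_chainDensity μ' μ hd.measurable n
  rw [lintegral_congr (e fun _ => F),
    lintegral_congr (e fun n ω => chainDensity μ' μ h n ω * F ω),
    lintegral_tsum fun n => (hF.indicator (hs n)).aemeasurable,
    lintegral_tsum fun n => (((hM n).fun_mul hF).indicator (hs n)).aemeasurable]
  refine tsum_congr fun n => ?_
  rw [hd.lintegral_eq n (hF.indicator (hs n)) fun ω => ?_]
  · refine lintegral_congr fun ω => ?_
    by_cases hω : ω ∈ τ ⁻¹' {n} <;> simp [hω]
  · by_cases hω : τ ω = n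
    · have h1 : F (freeze n ω) = F ω := by rw [← hω]; exact hFτ ω
      simp [hω, (hτ.freeze_eq_iff n ω).2 hω, h1]
    · have h1 := hω
      rw [← hτ.freeze_eq_iff] at h1
      simp [hω, h1]

theorem map_stopAt_eq_withDensity (hτ : IsStopIndex τ)
    (hd : IsTransitionDensity lam p' p μ' μ h) :
    (pathMeasure lam p' μ').map (stopAt τ) = ((pathMeasure lam p μ).map (stopAt τ)).withDensity
      fun ω => chainDensity μ' μ h (τ ω) ω := by
  have hm := hτ.measurable_chainDensity μ' μ hd.measurable
  refine Measure.ext_of_lintegral _ fun f hf => ?_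
  rw [lintegral_map hf hτ.measurable_stopAt,
    hτ.lintegral_eq hd (F := fun ω => f (stopAt τ ω)) (hf.comp hτ.measurable_stopAt)
      (fun ω => by rw [hτ.stopAt_stopAt]),
    lintegral_withDensity_eq_lintegral_mul _ hm hf,
    lintegral_map (hm.mul hf) hτ.measurable_stopAt]
  refine lintegral_congr fun ω => ?_
  rw [Pi.mul_apply, hτ.chainDensity_stopAt]

theorem klDiv_map_stopAt (hτ : IsStopIndex τ) (hd : IsTransitionDensity lam p' p μ' μ h) :
    klDiv ((pathMeasure lam p' μ').map (stopAt τ)) ((pathMeasure lam p μ).map (stopAt τ))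
      = ∫⁻ ω, klFunENN (chainDensity μ' μ h (τ ω) ω) ∂pathMeasure lam p μ := by
  have hm := hτ.measurable_chainDensity μ' μ hd.measurable
  have hmap := hτ.map_stopAt_eq_withDensity hd
  have hp := Measure.isProbabilityMeasure_map (μ := pathMeasure lam p' μ')
    hτ.measurable_stopAt.aemeasurable
  have hfin : IsFiniteMeasure (((pathMeasure lam p μ).map (stopAt τ)).withDensity
      fun ω => chainDensity μ' μ h (τ ω) ω) := by
    rw [← hmap]; infer_instance
  rw [hmap, klDiv_withDensity hm, lintegral_map (by fun_prop) hτ.measurable_stopAt]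
  simp_rw [hτ.chainDensity_stopAt]

end IsStopIndex

/-! ### The relative entropy of the stopped paths -/

/-- Stopping a path earlier decreases the relative entropy. -/
theorem lintegral_klFunENN_min_le (hd : IsTransitionDensity lam p' p μ' μ h) {t : ℝ}
    (ht : 0 ≤ t) (n : ℕ) :
    ∫⁻ ω, klFunENN (chainDensity μ' μ h (min (jumpCount t ω) n) ω) ∂pathMeasure lam p μ
      ≤ ∫⁻ ω, klFunENN (chainDensity μ' μ h (jumpCount t ω) ω) ∂pathMeasure lam p μ := by
  have hN := isStopIndex_jumpCount (X := X) ht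
  have hτ := isStopIndex_min_jumpCount (X := X) ht n
  rw [← hτ.klDiv_map_stopAt hd, ← hN.klDiv_map_stopAt hd]
  -- The path stopped earlier is a function of the path stopped later, so data processing applies.
  have e : stopAt (fun ω : Path X => min (jumpCount t ω) n) ∘ stopAt (jumpCount t)
      = stopAt fun ω : Path X => min (jumpCount t ω) n := by
    ext1 ω
    rw [Function.comp_apply, stopAt, hN.apply_stopAt, stopAt, freeze_freeze,
      min_eq_left (min_le_left _ _), stopAt]
  rw [← e, ← Measure.map_map hτ.measurable_stopAt hN.measurable_stopAt,
    ← Measure.map_map hτ.measurable_stopAt hN.measurable_stopAt]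
  have h1 := Measure.isProbabilityMeasure_map (μ := pathMeasure lam p' μ')
    hN.measurable_stopAt.aemeasurable
  have h2 := Measure.isProbabilityMeasure_map (μ := pathMeasure lam p μ)
    hN.measurable_stopAt.aemeasurable
  exact klDiv_map_le _ _ hτ.measurable_stopAt

omit [IsProbabilityMeasure μ'] [IsProbabilityMeasure μ] in
theorem chainDensity_min_succ {t : ℝ} (ht : 0 ≤ t) (n : ℕ) (ω : Path X) :
    chainDensity μ' μ h (min (jumpCount t ω) (n + 1)) ω
      = chainDensity μ' μ h (min (jumpCount t ω) n) ω *
        if jumpTime (n + 1) ω ≤ t then h (jumpChain n ω) (jumpChain (n + 1) ω) else 1 := by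
  simp only [jumpTime_le_iff ht]
  split_ifs with hn
  · rw [min_eq_right hn, min_eq_right (by omega), chainDensity_succ]
  · rw [min_eq_left (by omega), min_eq_left (by omega), mul_one]

/-- Given the states up to `n`, it is already decided whether `J_{n+1} ≤ t`. If so, the density
gains the factor `h(X^J_n, ·)` and the chain rule yields an extra `Z_n K(X^J_n)`; the weight `Z_n`
turns its expectation into one under the primed law. -/
theorem lintegral_klFunENN_min_succ (hd : IsTransitionDensity lam p' p μ' μ h) {t : ℝ}
    (ht : 0 ≤ t) (n : ℕ) :
    ∫⁻ ω, klFunENN (chainDensity μ' μ h (min (jumpCount t ω) (n + 1)) ω) ∂pathMeasure lam p μ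
      = ∫⁻ ω, klFunENN (chainDensity μ' μ h (min (jumpCount t ω) n) ω) ∂pathMeasure lam p μ
        + ∫⁻ ω, (if jumpTime (n + 1) ω ≤ t then
            ∫⁻ y, klFunENN (h (jumpChain n ω) y) ∂p (jumpChain n ω) else 0)
          ∂pathMeasure lam p' μ' := by
  have hh := hd.measurable
  have hτ := isStopIndex_min_jumpCount (X := X) ht n
  have hm := hτ.measurable_chainDensity μ' μ hh
  have hms : MeasurableSet {ω : Path X | jumpTime (n + 1) ω ≤ t} :=
    measurableSet_le (measurable_jumpTime _) measurable_const
  have hfr : ∀ ω : Path X, chainDensity μ' μ h (min (jumpCount t (freeze n ω)) n) (freeze n ω)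
      = chainDensity μ' μ h (min (jumpCount t ω) n) ω := fun ω => by
    rw [chainDensity_freeze μ' μ h (min_le_right _ _)]
    congr 1
    -- Freezing at `n` may change the jump count itself, but not its truncation at `n`: for `k ≤ n`,
    -- whether `J_k ≤ t` is unaffected.
    refine eq_of_forall_le_iff fun k => ?_
    rw [le_min_iff, le_min_iff, ← jumpTime_le_iff ht, ← jumpTime_le_iff ht]
    refine and_congr_left fun hk => ?_
    rw [jumpTime_freeze (by omega)]
  have hk : Measurable fun x => ∫⁻ y, klFunENN (h x y) ∂p x :=
    Measurable.lintegral_kernel_prod_right (f := fun x y => klFunENN (h x y))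
      (measurable_klFunENN.comp hh)
  have hk' : Measurable fun ω : Path X => if jumpTime (n + 1) ω ≤ t then
      ∫⁻ y, klFunENN (h (jumpChain n ω) y) ∂p (jumpChain n ω) else 0 :=
    Measurable.ite hms (hk.comp (measurable_jumpChain n)) measurable_const
  simp_rw [chainDensity_min_succ ht]
  rw [hd.lintegral_eq n hk' fun ω => by
      simp only [jumpTime_freeze le_rfl, jumpChain_freeze le_rfl],
    ← lintegral_add_left (by fun_prop),
    lintegral_pathMeasure_succ lam p μ n (G := fun ω x _ => klFunENN
      (chainDensity μ' μ h (min (jumpCount t ω) n) ω *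
        if jumpTime (n + 1) ω ≤ t then h (jumpChain n ω) x else 1))
      (measurable_klFunENN.comp ((hm.comp measurable_fst).mul
        (Measurable.ite (measurable_fst hms) (hh.comp
          (show Measurable fun y : Path X × X × HoldingTime => (jumpChain n y.1, y.2.1) by
            fun_prop)) measurable_const)))
      (fun ω => by
        simp only [hfr, jumpTime_freeze le_rfl, jumpChain_freeze le_rfl])]
  simp only [lintegral_const, measure_univ, mul_one]
  have hfin : ∀ᵐ ω ∂pathMeasure lam p μ, chainDensity μ' μ h n ω < ∞ :=
    ae_lt_top (measurable_chainDensity μ' μ hh n) (by rw [hd.lintegral_chainDensity]; simp)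
  refine lintegral_congr_ae ?_
  filter_upwards [hfin, hd.ae_withDensity_eq n] with ω hω1 hω2
  by_cases hJ : jumpTime (n + 1) ω ≤ t
  · simp only [hJ, if_true]
    rw [min_eq_right ((Nat.le_succ n).trans ((jumpTime_le_iff ht _ _).1 hJ))]
    -- Where `Z_n = 0`, `h` need not be a transition density, but then both sides reduce to
    -- `klFunENN 0`.
    rcases hω2 with h0 | h0
    · simp [h0]
    · refine lintegral_klFunENN_mul hh.of_uncurry_left ?_ hω1.ne
      rw [← setLIntegral_univ, ← withDensity_apply _ .univ, ← h0, measure_univ]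
  · simp [hJ]

/-- The one-step increments are summed up to a cap `n` on the jump count. As `n` grows, each path
eventually ignores the cap, so Fatou gives `≤`; the data processing bound for the capped index gives
`≥`. -/
theorem lintegral_klFunENN_chainDensity (hd : IsTransitionDensity lam p' p μ' μ h) {t : ℝ}
    (ht : 0 ≤ t) :
    ∫⁻ ω, klFunENN (chainDensity μ' μ h (jumpCount t ω) ω) ∂pathMeasure lam p μ
      = klDiv μ' μ + ∑' n, ∫⁻ ω, (if jumpTime (n + 1) ω ≤ t then
            ∫⁻ y, klFunENN (h (jumpChain n ω) y) ∂p (jumpChain n ω) else 0)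
          ∂pathMeasure lam p' μ' := by
  have h0 : ∫⁻ ω, klFunENN (chainDensity μ' μ h (min (jumpCount t ω) 0) ω) ∂pathMeasure lam p μ
      = klDiv μ' μ := by
    rw [klDiv_eq_lintegral_klFun_of_ac hd.absolutelyContinuous]
    simp only [chainDensity, Nat.min_zero, Finset.range_zero, Finset.prod_empty, mul_one]
    have hm : Measurable fun y : X × HoldingTime => klFunENN (μ'.rnDeriv μ y.1) := by fun_prop
    rw [lintegral_pathMeasure_zero lam p μ (G := fun x _ => klFunENN (μ'.rnDeriv μ x)) hm]
    simp [klFunENN]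
  have hsum : ∀ n,
      ∫⁻ ω, klFunENN (chainDensity μ' μ h (min (jumpCount t ω) n) ω) ∂pathMeasure lam p μ
        = klDiv μ' μ + ∑ k ∈ Finset.range n, ∫⁻ ω, (if jumpTime (k + 1) ω ≤ t then
            ∫⁻ y, klFunENN (h (jumpChain k ω) y) ∂p (jumpChain k ω) else 0)
          ∂pathMeasure lam p' μ' := fun n => by
    induction n with
    | zero => rw [h0]; simp
    | succ n ih => rw [lintegral_klFunENN_min_succ hd ht, ih, Finset.sum_range_succ, add_assoc]
  refine le_antisymm ?_ ?_
  · have hlim : ∀ ω : Path X, liminf (fun n =>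
        klFunENN (chainDensity μ' μ h (min (jumpCount t ω) n) ω)) atTop
          = klFunENN (chainDensity μ' μ h (jumpCount t ω) ω) := fun ω => by
      refine Tendsto.liminf_eq (tendsto_const_nhds.congr' ?_)
      filter_upwards [eventually_ge_atTop (jumpCount t ω)] with n hn
      rw [min_eq_left hn]
    simp_rw [← hlim]
    refine (lintegral_liminf_le fun n => measurable_klFunENN.comp
      ((isStopIndex_min_jumpCount ht n).measurable_chainDensity μ' μ hd.measurable)).trans ?_
    refine liminf_le_of_le (by isBoundedDefault) fun b hb => ?_
    obtain ⟨n, hn⟩ := hb.exists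
    exact (hn.trans (hsum n).le).trans (add_le_add_right (ENNReal.sum_le_tsum _) _)
  · refine le_of_tendsto' (tendsto_const_nhds.add ENNReal.summable.tendsto_sum_tsum_nat)
      fun n => ?_
    rw [← hsum]
    exact lintegral_klFunENN_min_le hd ht n

end JumpProcess

namespace JumpProcess

variable {X : Type*} [MeasurableSpace X]

/-! ### Measurability with respect to the two filtrations -/

theorem measurable_enlargedFiltration_process_min {s t : ℝ≥0} (hst : s ≤ t) (n : ℕ) :
    Measurable[enlargedFiltration X t] fun ω : Path X => process (min (jumpTime n ω) s) ω :=
  (comap_measurable _).mono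
    (le_iSup₂_of_le (f := fun (s : ℝ≥0) (_ : s ≤ t) => ⨆ n : ℕ,
      MeasurableSpace.comap ({ω : Path X | jumpTime n ω ≤ s}.indicator fun _ => (1 : ℝ))
        inferInstance ⊔
      MeasurableSpace.comap (fun ω : Path X => process (min (jumpTime n ω) s) ω) inferInstance)
      s hst (le_iSup_of_le n le_sup_right)) le_rfl

theorem measurableSet_enlargedFiltration_jumpTime_le {s t : ℝ≥0} (hst : s ≤ t) (n : ℕ) :
    MeasurableSet[enlargedFiltration X t] {ω : Path X | jumpTime n ω ≤ s} := by
  have h : Measurable[enlargedFiltration X t]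
      ({ω : Path X | jumpTime n ω ≤ s}.indicator fun _ => (1 : ℝ)) :=
    (comap_measurable _).mono
      (le_iSup₂_of_le (f := fun (s : ℝ≥0) (_ : s ≤ t) => ⨆ n : ℕ,
        MeasurableSpace.comap ({ω : Path X | jumpTime n ω ≤ s}.indicator fun _ => (1 : ℝ))
          inferInstance ⊔
        MeasurableSpace.comap (fun ω : Path X => process (min (jumpTime n ω) s) ω) inferInstance)
        s hst (le_iSup_of_le n le_sup_left)) le_rfl
  have e : {ω : Path X | jumpTime n ω ≤ s}
      = ({ω : Path X | jumpTime n ω ≤ s}.indicator fun _ => (1 : ℝ)) ⁻¹' {1} := by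
    ext ω
    by_cases hω : jumpTime n ω ≤ s <;> simp [hω]
  rw [e]
  exact h (measurableSet_singleton 1)

/-- On `s < J_n` one has `X_{J_n ∧ s} = X_s`, and by non-explosion these events cover the sample
space. -/
theorem measurable_enlargedFiltration_process {s t : ℝ≥0} (hst : s ≤ t) :
    Measurable[enlargedFiltration X t] fun ω : Path X => process s ω := by
  intro B hB
  have e : (fun ω : Path X => process s ω) ⁻¹' B = ⋃ n, {ω : Path X | jumpTime n ω ≤ s}ᶜ ∩
      (fun ω : Path X => process (min (jumpTime n ω) s) ω) ⁻¹' B := by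
    ext ω
    simp only [mem_preimage, mem_iUnion, mem_inter_iff, mem_compl_iff, mem_ofPred_eq, not_le]
    constructor
    · intro h
      obtain ⟨n, hn⟩ := exists_lt_jumpTime s ω
      exact ⟨n + 1, hn, by rwa [min_eq_right hn.le]⟩
    · rintro ⟨n, hn, h⟩
      rwa [min_eq_right hn.le] at h
  rw [e]
  exact MeasurableSet.iUnion fun n =>
    (measurableSet_enlargedFiltration_jumpTime_le hst n).compl.inter
      (measurable_enlargedFiltration_process_min hst n hB)

theorem naturalFiltration_le_enlargedFiltration (t : ℝ≥0) :
    naturalFiltration X t ≤ enlargedFiltration X t :=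
  iSup₂_le fun _ hs => (measurable_enlargedFiltration_process hs).comap_le

theorem measurable_enlargedFiltration_jumpCount (t : ℝ≥0) :
    Measurable[enlargedFiltration X t] (jumpCount (X := X) t) := by
  refine @measurable_to_countable' _ _ _ _ (enlargedFiltration X t) _ fun n => ?_
  have e : jumpCount (X := X) t ⁻¹' {n}
      = {ω | jumpTime n ω ≤ t} ∩ {ω | jumpTime (n + 1) ω ≤ t}ᶜ := by
    ext ω
    simp [jumpCount_eq_iff t.coe_nonneg]
  rw [e]
  exact (measurableSet_enlargedFiltration_jumpTime_le le_rfl n).inter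
    (measurableSet_enlargedFiltration_jumpTime_le le_rfl (n + 1)).compl

theorem measurable_prod_Icc {α : Type*} {mα : MeasurableSpace α} {N : α → ℕ} (hN : Measurable N)
    {f : ℕ → α → ℝ≥0∞} (hf : ∀ n, Measurable (f n)) :
    Measurable fun a => ∏ n ∈ Finset.Icc 1 (N a), f n a := by
  have h : Measurable fun y : ℕ × α => ∏ n ∈ Finset.Icc 1 y.1, f n y.2 :=
    measurable_from_prod_countable_right fun m =>
      Finset.measurable_prod (Finset.Icc 1 m) fun n _ => hf n
  exact h.comp (hN.prodMk measurable_id)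

theorem measurable_enlargedFiltration_pathDensity (μ' μ : Measure X) {h : X → X → ℝ≥0∞}
    (hh : Measurable (Function.uncurry h)) (t : ℝ≥0) :
    Measurable[enlargedFiltration X t] (pathDensity μ' μ h t) := by
  have h0 : Measurable[enlargedFiltration X t] fun ω : Path X => μ'.rnDeriv μ (process 0 ω) :=
    (Measure.measurable_rnDeriv μ' μ).comp (measurable_enlargedFiltration_process (s := 0)
      (zero_le : 0 ≤ t))
  have h1 : ∀ n, Measurable[enlargedFiltration X t] fun ω : Path X =>
      h (process (min (jumpTime (n - 1) ω) t) ω) (process (min (jumpTime n ω) t) ω) := fun n =>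
    hh.comp ((measurable_enlargedFiltration_process_min le_rfl (n - 1)).prodMk
      (measurable_enlargedFiltration_process_min le_rfl n))
  exact h0.mul (measurable_prod_Icc (measurable_enlargedFiltration_jumpCount t) h1)

/-- The events of the enlarged filtration at time `t` only depend on the states up to time `t`. -/
theorem enlargedFiltration_le_invariants (t : ℝ≥0) :
    enlargedFiltration X t ≤ MeasurableSpace.invariants (stopAt (jumpCount (X := X) t)) := by
  refine iSup₂_le fun s hs => iSup_le fun n => ?_
  have hst : (s : ℝ) ≤ t := hs
  refine sup_le (Measurable.comap_le ?_) (Measurable.comap_le ?_) <;>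
    rw [MeasurableSpace.measurable_invariants_dom]
  · refine ⟨measurable_const.indicator (measurableSet_le (measurable_jumpTime n)
      measurable_const), fun B _ => ?_⟩
    congr 1
    ext ω
    simp only [Function.comp_apply, indicator_apply, mem_ofPred_eq, stopAt,
      jumpTime_le_freeze s.coe_nonneg hst]
  · refine ⟨measurable_process_comp ((measurable_jumpTime n).min measurable_const), fun B _ => ?_⟩
    congr 1
    ext1 ω
    simp only [Function.comp_apply, stopAt, min_jumpTime_freeze s.coe_nonneg hst]
    exact process_freeze (le_min (jumpTime_nonneg n ω) s.coe_nonneg) ((min_le_right _ _).trans hst) ω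

theorem pathDensity_eq_chainDensity (μ' μ : Measure X) (h : X → X → ℝ≥0∞) (t : ℝ≥0)
    (ω : Path X) : pathDensity μ' μ h t ω = chainDensity μ' μ h (jumpCount t ω) ω := by
  have e : ∀ n ≤ jumpCount t ω, process (min (jumpTime n ω) t) ω = jumpChain n ω := fun n hn => by
    rw [min_eq_left ((jumpTime_le_iff t.coe_nonneg n ω).2 hn), process_jumpTime]
  rw [pathDensity, chainDensity, process_zero, Finset.range_eq_Ico,
    ← Finset.Ico_add_one_right_eq_Icc, ← zero_add 1, ← Finset.prod_Ico_add']
  congr 1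
  refine Finset.prod_congr rfl fun n hn => ?_
  have := Finset.mem_Ico.1 hn
  rw [e _ (by omega), e _ (by omega), Nat.add_sub_cancel]

/-! ### The relative entropy on the two filtrations -/

variable {lam : Ioi (0 : ℝ)} {p' p : Kernel X X} [IsMarkovKernel p'] [IsMarkovKernel p]
  {μ' μ : Measure X} [IsProbabilityMeasure μ'] [IsProbabilityMeasure μ] {h : X → X → ℝ≥0∞}

/-- An event of `𝓖_t` is its own preimage under stopping at `N_t`, so the change of measure at that
index applies to its indicator. -/
theorem restrictG_eq_withDensity (hd : IsTransitionDensity lam p' p μ' μ h) (t : ℝ≥0) :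
    restrictG (pathMeasure lam p' μ') t
      = (restrictG (pathMeasure lam p μ) t).withDensity (pathDensity μ' μ h t) := by
  refine @Measure.ext _ (enlargedFiltration X t) _ _ fun s hs => ?_
  have hle := (enlargedFiltration X).le t
  have hinv : stopAt (jumpCount (X := X) t) ⁻¹' s = s :=
    (enlargedFiltration_le_invariants t s hs).2
  have hm := measurable_enlargedFiltration_pathDensity μ' μ hd.measurable t
  rw [withDensity_apply _ hs, restrictG, restrictG, trim_measurableSet_eq hle hs,
    restrict_trim hle _ hs, lintegral_trim hle hm, ← lintegral_indicator_one (hle s hs),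
    (isStopIndex_jumpCount t.coe_nonneg).lintegral_eq hd (measurable_one.indicator (hle s hs)) fun ω => ?_,
    ← lintegral_indicator (hle s hs)]
  · refine lintegral_congr fun ω => ?_
    by_cases hω : ω ∈ s <;> simp [hω, pathDensity_eq_chainDensity]
  · have : stopAt (jumpCount (X := X) t) ω ∈ s ↔ ω ∈ s := by
      rw [← mem_preimage, hinv]
    by_cases hω : ω ∈ s <;> simp [this, hω]

instance (P : Measure (Path X)) [IsProbabilityMeasure P] (t : ℝ≥0) :
    IsProbabilityMeasure (restrictG P t) := ⟨by
  rw [restrictG, trim_measurableSet_eq _ .univ, measure_univ]⟩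

/-- The stopped path also records the full current holding time, which runs beyond `t`. This costs
nothing: the density is `𝓖_t`-measurable, so both descriptions give the same entropy. -/
theorem klDiv_restrictG (hd : IsTransitionDensity lam p' p μ' μ h) (t : ℝ≥0) :
    klDiv (restrictG (pathMeasure lam p' μ') t) (restrictG (pathMeasure lam p μ) t)
      = klDiv μ' μ + ∑' n, ∫⁻ ω, (if jumpTime (n + 1) ω ≤ t then
            ∫⁻ y, klFunENN (h (jumpChain n ω) y) ∂p (jumpChain n ω) else 0)
          ∂pathMeasure lam p' μ' := by
  have hG := restrictG_eq_withDensity hd t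
  have hm := measurable_enlargedFiltration_pathDensity μ' μ hd.measurable t
  have hfin : IsFiniteMeasure
      ((restrictG (pathMeasure lam p μ) t).withDensity (pathDensity μ' μ h t)) := by
    rw [← hG]; infer_instance
  have hm' : Measurable[enlargedFiltration X t] fun ω => klFunENN (pathDensity μ' μ h t ω) :=
    measurable_klFunENN.comp hm
  rw [hG, klDiv_withDensity hm, restrictG, lintegral_trim _ hm', ← lintegral_klFunENN_chainDensity hd t.coe_nonneg]
  simp_rw [pathDensity_eq_chainDensity]

theorem klDiv_restrictF_le_klDiv_restrictG (P' P : Measure (Path X)) [IsProbabilityMeasure P']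
    [IsProbabilityMeasure P] (t : ℝ≥0) :
    klDiv (restrictF P' t) (restrictF P t) ≤ klDiv (restrictG P' t) (restrictG P t) := by
  have hle := naturalFiltration_le_enlargedFiltration (X := X) t
  have e : ∀ Q : Measure (Path X), restrictF Q t = (restrictG Q t).trim hle := fun Q => by
    rw [restrictG, trim_trim, restrictF]
  rw [e, e]
  exact klDiv_trim_le _ _ hle

omit [IsProbabilityMeasure μ'] [IsProbabilityMeasure μ] in
theorem eintegral_localEntropy (hd : IsTransitionDensity lam p' p μ' μ h) {s : ℝ} :
    eintegral (pathMeasure lam p' μ') (fun ω => localEntropy p h (process s ω))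
      = ((∫⁻ ω, ∫⁻ y, klFunENN (h (process s ω) y) ∂p (process s ω)
          ∂pathMeasure lam p' μ' : ℝ≥0∞) : EReal) := by
  obtain ⟨B, -, hB, hB'⟩ := hd.exists_null_set
  rw [← eintegral_coe]
  refine eintegral_congr_ae ?_
  -- The whole jump chain avoids the exceptional set at once, so `X_s` avoids it whatever the random
  -- index `N_s` is.
  filter_upwards [ae_all_iff.2 hB'] with ω hω
  have h0 := hB _ (hω (jumpCount s ω))
  refine eintegral_mul_log hd.measurable.of_uncurry_left ?_
  rw [← setLIntegral_univ, ← withDensity_apply _ .univ, process, ← h0, measure_univ]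

theorem coe_klDiv_restrictG (hd : IsTransitionDensity lam p' p μ' μ h) (t : ℝ≥0) :
    ((klDiv (restrictG (pathMeasure lam p' μ') t) (restrictG (pathMeasure lam p μ) t) : ℝ≥0∞) :
        EReal)
      = ((klDiv μ' μ : ℝ≥0∞) : EReal) + ((lam : ℝ) : EReal) *
          eintegral (volume.restrict (Icc (0 : ℝ) t)) (fun s =>
            eintegral (pathMeasure lam p' μ') (fun ω => localEntropy p h (process s ω))) := by
  have hk : Measurable fun x => ∫⁻ y, klFunENN (h x y) ∂p x :=
    Measurable.lintegral_kernel_prod_right (f := fun x y => klFunENN (h x y))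
      (measurable_klFunENN.comp hd.measurable)
  simp_rw [eintegral_localEntropy hd]
  rw [eintegral_coe, klDiv_restrictG hd, tsum_lintegral_jumpTime_le lam p' μ' t hk,
    EReal.coe_ennreal_add, EReal.coe_ennreal_mul, EReal.coe_ennreal_ofReal,
    max_eq_left (le_of_lt lam.2)]

omit [IsProbabilityMeasure μ'] in
theorem exists_transition_density [MeasurableSpace.CountableOrCountablyGenerated X X]
    (hac : ∀ᵐ x ∂μ', p' x ≪ p x) :
    ∃ h : X → X → ℝ≥0∞, Measurable (Function.uncurry h) ∧ (∀ x y, h x y ≠ ∞) ∧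
      ∀ᵐ x ∂μ', p' x = (p x).withDensity (h x) := by
  have hm := Kernel.measurable_rnDeriv p' p
  refine ⟨fun x y => if Kernel.rnDeriv p' p x y = ∞ then 0 else Kernel.rnDeriv p' p x y,
    Measurable.ite (hm (measurableSet_singleton ∞)) measurable_const hm,
    fun x y => by
      dsimp only
      split_ifs with h <;> simp [h], ?_⟩
  filter_upwards [hac] with x hx
  rw [withDensity_congr_ae (g := Kernel.rnDeriv p' p x), ← Kernel.withDensity_apply _ hm,
    Kernel.withDensity_rnDeriv_eq hx]
  filter_upwards [Kernel.rnDeriv_ne_top p' p (a := x)] with y hy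
  simp [hy]

theorem klDiv_restrictF_le_of_invariant [MeasurableSpace.CountableOrCountablyGenerated X X]
    (hinv : Kernel.Invariant p' μ') {t : ℝ≥0} (ht : 0 < t) :
    klDiv (restrictF (pathMeasure lam p' μ') t) (restrictF (pathMeasure lam p μ) t)
      ≤ klDiv μ' μ + ENNReal.ofReal (lam * t) * ∫⁻ x, klDiv (p' x) (p x) ∂μ' := by
  have hlt : (0 : ℝ) < lam * t := mul_pos lam.2 ht
  by_cases h1 : klDiv μ' μ = ∞
  · simp [h1]
  by_cases h2 : ∫⁻ x, klDiv (p' x) (p x) ∂μ' = ∞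
  -- Positivity of `t` matters here: at `t = 0` the product would be `0 * ∞ = 0`.
  · rw [h2, ENNReal.mul_top (ENNReal.ofReal_pos.2 hlt).ne', add_top]
    exact le_top
  have hac : μ' ≪ μ := (klDiv_ne_top_iff.1 h1).1
  have hD := Kernel.measurableSet_absolutelyContinuous p' p
  have hpac : ∀ᵐ x ∂μ', p' x ≪ p x := by
    -- The relative entropy is infinite wherever absolute continuity fails, so a finite integral
    -- makes that set null.
    have h3 : ∫⁻ x, {x | p' x ≪ p x}ᶜ.indicator (fun _ => ∞) x ∂μ'
        ≤ ∫⁻ x, klDiv (p' x) (p x) ∂μ' := by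
      refine lintegral_mono fun x => ?_
      by_cases hx : p' x ≪ p x
      · simp [hx]
      · simp [klDiv_of_not_ac hx]
    rw [lintegral_indicator_const hD.compl] at h3
    by_contra h4
    rw [ENNReal.top_mul (by exact h4)] at h3
    exact h2 (top_le_iff.1 h3)
  obtain ⟨h, hh, -, hd⟩ := exists_transition_density hpac
  have hT : IsTransitionDensity lam p' p μ' μ h := .of_ae hac hh hd fun n => by
    rw [Function.iterate_fixed hinv.def]
  have hk : Measurable fun x => ∫⁻ y, klFunENN (h x y) ∂p x :=
    Measurable.lintegral_kernel_prod_right (f := fun x y => klFunENN (h x y))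
      (measurable_klFunENN.comp hh)
  refine (klDiv_restrictF_le_klDiv_restrictG _ _ t).trans ?_
  rw [klDiv_restrictG hT, tsum_lintegral_jumpTime_le_of_invariant lam p' μ' hinv t hk]
  refine le_of_eq ?_
  congr 2
  refine lintegral_congr_ae ?_
  filter_upwards [hd] with x hx
  have hfin : IsFiniteMeasure ((p x).withDensity (h x)) := by rw [← hx]; infer_instance
  rw [hx, klDiv_withDensity hh.of_uncurry_left]

end JumpProcess

/-! ### The main theorem -/

theorem mainTheorem10 {X : Type*} [TopologicalSpace X] [PolishSpace X] [MeasurableSpace X]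
    [BorelSpace X] (lam : ℝ) (hlam : 0 < lam)
    (μ' μ : Measure X) [IsProbabilityMeasure μ'] [IsProbabilityMeasure μ]
    (p' p : Kernel X X) [IsMarkovKernel p'] [IsMarkovKernel p] :
    -- the Radon-Nikodym derivative and the relative entropy on the enlarged filtration
    (μ' ≪ μ → (∀ᵐ x ∂μ', p' x ≪ p x) → (∀ n : ℕ, (fun ν => ν.bind p')^[n] μ' ≪ μ') →
      (∃ h : X → X → ℝ≥0∞, Measurable (Function.uncurry h) ∧ (∀ x y, h x y ≠ ∞) ∧
        ∀ᵐ x ∂μ', p' x = (p x).withDensity (h x)) ∧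
      ∀ h : X → X → ℝ≥0∞, Measurable (Function.uncurry h) →
        (∀ᵐ x ∂μ', p' x = (p x).withDensity (h x)) →
        ∀ t : ℝ≥0,
          let P' := JumpProcess.pathMeasure ⟨lam, hlam⟩ p' μ'
          let P := JumpProcess.pathMeasure ⟨lam, hlam⟩ p μ
          JumpProcess.restrictG P' t ≪ JumpProcess.restrictG P t ∧
          (JumpProcess.restrictG P' t).rnDeriv (JumpProcess.restrictG P t)
            =ᵐ[JumpProcess.restrictG P t] JumpProcess.pathDensity μ' μ h t ∧
          ((klDiv (JumpProcess.restrictG P' t) (JumpProcess.restrictG P t) : ℝ≥0∞) : EReal)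
            = ((klDiv μ' μ : ℝ≥0∞) : EReal) + (lam : EReal) *
                JumpProcess.eintegral (volume.restrict (Icc (0 : ℝ) t)) (fun s =>
                  JumpProcess.eintegral P' (fun ω =>
                    JumpProcess.localEntropy p h (JumpProcess.process s ω))) ∧
          JumpProcess.naturalFiltration X t ≤ JumpProcess.enlargedFiltration X t ∧
          klDiv (JumpProcess.restrictF P' t) (JumpProcess.restrictF P t)
            ≤ klDiv (JumpProcess.restrictG P' t) (JumpProcess.restrictG P t)) ∧
    -- the bound for an invariant initial law
    (Kernel.Invariant p' μ' → ∀ t : ℝ≥0, 0 < t →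
      klDiv (JumpProcess.restrictF (JumpProcess.pathMeasure ⟨lam, hlam⟩ p' μ') t)
          (JumpProcess.restrictF (JumpProcess.pathMeasure ⟨lam, hlam⟩ p μ) t)
        ≤ klDiv μ' μ + ENNReal.ofReal (lam * t) * ∫⁻ x, klDiv (p' x) (p x) ∂μ') := by
  refine ⟨fun hac hpac hit => ⟨JumpProcess.exists_transition_density hpac,
    fun h hh hd t => ?_⟩, fun hinv t ht => ?_⟩
  · have hT : JumpProcess.IsTransitionDensity ⟨lam, hlam⟩ p' p μ' μ h := .of_ae hac hh hd hit
    refine ⟨?_, ?_, JumpProcess.coe_klDiv_restrictG hT t,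
      JumpProcess.naturalFiltration_le_enlargedFiltration t,
      JumpProcess.klDiv_restrictF_le_klDiv_restrictG _ _ t⟩
    · rw [JumpProcess.restrictG_eq_withDensity hT]
      exact withDensity_absolutelyContinuous _ _
    · rw [JumpProcess.restrictG_eq_withDensity hT]
      exact Measure.rnDeriv_withDensity _
        (JumpProcess.measurable_enlargedFiltration_pathDensity μ' μ hh t)
  · exact JumpProcess.klDiv_restrictF_le_of_invariant (lam := ⟨lam, hlam⟩) hinv ht
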